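/- **Setting.** Let $P\subset\mathbb{R}^d$ be a simplicial $d$-polytope (the convex hull of finitely many points, of dimension $d$, all of whose facets are geometric simplices) whose vertices are labelled by a finite set $V$, with $p(v)\in\mathbb{R}^d$ the position of the vertex $v\in V$. Its boundary complex $\partial P$ consists of $\emptyset$ and of all $W\subseteq V$ that are vertex sets of proper faces of $P$ (intersections of $P$ with supporting hyperplanes). A face $F\in\partial P$ has dimension $|F|-1$; the $(k-1)$-skeleton of $\partial P$ is the set of its faces with at most $k$ elements; a missing face is a set $M\subseteq V$ with $M\notin\partial P$ all of whose proper subsets are in $\partial P$. An affine $k$-stress on $P$ is a homogeneous polynomial $\lambda\in\mathbb{R}[x_v: v\in V]$ of degree $k$ such that every monomial occurring in $\lambda$ has its support in $\partial P$, and $\sum_{v}p(v)_i\,\frac{\partial\lambda}{\partial x_v}=0$ for $i=1,\dots,d$ and $\sum_v\frac{\partial\lambda}{\partial x_v}=0$. For $G\subseteq V$, $\lambda_G$ denotes the coefficient of $\prod_{v\in G}x_v$ in $\lambda$. Let $\mathcal{V}_k(P)$ be the set of the sign vectors $(\operatorname{sign}\lambda_G)_{|G|=k}\in\{+,-,0\}^{\binom{V}{k}}$,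 where $\lambda$ runs over the affine $k$-stresses on $P$ (the entries at $k$-sets $G\notin\partial P$ are $0$). **Lemma.** Let $k\ge 2$ and $d\ge 2k$, and let $P\subset\mathbb{R}^d$ be a simplicial $d$-polytope with vertex set labelled by $V$. Suppose that for every missing face $M$ of $\partial P$ with $k\le\dim M\le d-k$ there are a $(k-2)$-face $F\subset M$ of $\partial P$ and an affine $k$-stress $\lambda$ on $P$ such that for every $(k-1)$-face $G=F\cup\{v\}$ of $\partial P$ one has $\lambda_G>0$ if $v\in M$, and $\lambda_G\le 0$ if $v\notin M$. Then the $(k-1)$-skeleton of $\partial P$ and the set $\mathcal{V}_k(P)$ determine $\partial P$: if $Q\subset\mathbb{R}^d$ is any simplicial $d$-polytope with vertices labelled by $V$ such that $\partial Q$ and $\partial P$ have the same $(k-1)$-skeleton and $\mathcal{V}_k(Q)=\mathcal{V}_k(P)$, then $\partial Q=\partial P$. -/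

import Mathlib

noncomputable section

namespace StressRec

/-! ### Polytopes -/

/-- `F` is a proper face of `P ⊆ ℝ^d`: the nonempty intersection of `P` with a hyperplane
`{x | ⟪b, x⟫ = α}` such that `P` lies in one of its closed half-spaces. -/
def IsProperFace {d : ℕ} (P F : Set (EuclideanSpace ℝ (Fin d))) : Prop :=
  ∃ (b : EuclideanSpace ℝ (Fin d)) (α : ℝ), b ≠ 0 ∧ (∀ x ∈ P, α ≤ inner ℝ b x) ∧
    F = {x ∈ P | inner ℝ b x = α} ∧ F.Nonempty

/-- A geometric simplex: the convex hull of a finite affinely independent set of points. -/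
def IsGeometricSimplex {d : ℕ} (F : Set (EuclideanSpace ℝ (Fin d))) : Prop :=
  ∃ s : Finset (EuclideanSpace ℝ (Fin d)),
    AffineIndependent ℝ ((↑) : s → EuclideanSpace ℝ (Fin d)) ∧
      F = convexHull ℝ (s : Set (EuclideanSpace ℝ (Fin d)))

/-- A simplicial `d`-polytope in `ℝ^d` whose vertices are labelled by `V`; `pos v` is the position
vector of the vertex `v`, and the polytope itself is the convex hull of the points `pos v`. -/
structure SimplicialPolytope (d : ℕ) (V : Type*) [Fintype V] where
  /-- the position vectors of the vertices -/
  pos : V → EuclideanSpace ℝ (Fin d)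
  /-- distinct labels are distinct vertices -/
  pos_injective : Function.Injective pos
  /-- the points `pos v` are exactly the vertices of their convex hull -/
  vertices_eq : (convexHull ℝ (Set.range pos)).extremePoints ℝ = Set.range pos
  /-- the polytope is `d`-dimensional -/
  full_dim : affineSpan ℝ (Set.range pos) = ⊤
  /-- every facet (proper face of dimension `d - 1`) is a geometric simplex -/
  simplicial : ∀ F, IsProperFace (convexHull ℝ (Set.range pos)) F →
    Module.finrank ℝ (vectorSpan ℝ F) + 1 = d → IsGeometricSimplex F

/-! ### Set systems on the vertex set -/

/-- The faces of dimension at most `k - 1`, that is, with at most `k` elements. -/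
def skel {V : Type*} (k : ℕ) (Δ : Set (Finset V)) : Set (Finset V) :=
  {F ∈ Δ | F.card ≤ k}

/-- `M` is a missing face of `Δ`: not a face, but all its proper subsets are faces. -/
def IsMissingFace {V : Type*} (Δ : Set (Finset V)) (M : Finset V) : Prop :=
  M ∉ Δ ∧ ∀ σ : Finset V, σ ⊂ M → σ ∈ Δ

/-! ### Affine stresses -/

/-- The coefficient `θ_{iv}`: the `i`-th entry of the column `p v` augmented by a last entry `1`. -/
def theta {d : ℕ} {V : Type*} (p : V → EuclideanSpace ℝ (Fin d)) (i : Fin (d + 1)) (v : V) : ℝ :=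
  Fin.snoc (α := fun _ => ℝ) (fun j : Fin d => p v j) 1 i

/-- The operator `∂_ℓ = ∑ v, ℓ_v ∂/∂x_v` for the linear form `ℓ = ∑ v, ℓ_v x_v`. -/
def formDeriv {V : Type*} [Fintype V] (l : V → ℝ) (q : MvPolynomial V ℝ) : MvPolynomial V ℝ :=
  ∑ v, l v • MvPolynomial.pderiv v q

/-- `lam` is an affine `k`-stress on `(Δ, p)`. -/
def IsAffineStress {d : ℕ} {V : Type*} [Fintype V] (Δ : Set (Finset V))
    (p : V → EuclideanSpace ℝ (Fin d)) (k : ℕ) (lam : MvPolynomial V ℝ) : Prop :=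
  lam.IsHomogeneous k ∧ (∀ m ∈ lam.support, m.support ∈ Δ) ∧
    ∀ i : Fin (d + 1), formDeriv (theta p i) lam = 0

/-- The coefficient `λ_G` of the squarefree monomial with support `G`. -/
def sqfreeCoeff {V : Type*} (lam : MvPolynomial V ℝ) (G : Finset V) : ℝ :=
  lam.coeff (∑ v ∈ G, Finsupp.single v 1)

namespace SimplicialPolytope

variable {d : ℕ} {V : Type*} [Fintype V]

/-- The boundary complex `∂P`: the empty set and the vertex sets of the proper faces. -/
def boundary (P : SimplicialPolytope d V) : Set (Finset V) :=
  {W | W = ∅ ∨ ∃ F, IsProperFace (convexHull ℝ (Set.range P.pos)) F ∧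
    ∀ v, v ∈ W ↔ P.pos v ∈ F}

/-- The affine `k`-stresses on `P`, with its natural embedding. -/
def IsStress (P : SimplicialPolytope d V) (k : ℕ) (lam : MvPolynomial V ℝ) : Prop :=
  IsAffineStress P.boundary P.pos k lam

/-- The set `𝒱_k(P)` of sign vectors of the squarefree parts of the affine `k`-stresses on `P`.
Sign vectors are indexed by all `k`-subsets `G` of the vertex set, so that the sets of different
polytopes can be compared; the entries at `k`-subsets which are not faces are `0`, because the terms
of a stress are supported on faces. -/
def signVectors (P : SimplicialPolytope d V) (k : ℕ) :
    Set ({G : Finset V // G.card = k} → SignType) :=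
  {s | ∃ lam, P.IsStress k lam ∧ ∀ G, s G = SignType.sign (sqfreeCoeff lam G.1)}

open Classical in
/-- The sign condition for `P`: every missing face `M` with `k ≤ dim M ≤ d - k` contains a
`(k-2)`-face `F` for which some affine `k`-stress `λ` on `P` satisfies, for every `(k-1)`-face
`G = F ∪ {v}`: `λ_G > 0` if `v ∈ M`, and `λ_G ≤ 0` if `v ∉ M`. -/
def SignCondition (P : SimplicialPolytope d V) (k : ℕ) : Prop :=
  ∀ M : Finset V, IsMissingFace P.boundary M → k + 1 ≤ M.card → M.card + k ≤ d + 1 →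
    ∃ F ∈ P.boundary, F ⊆ M ∧ F.card + 1 = k ∧
      ∃ lam, P.IsStress k lam ∧
        ∀ v, v ∉ F → insert v F ∈ P.boundary →
          (v ∈ M → 0 < sqfreeCoeff lam (insert v F)) ∧
          (v ∉ M → sqfreeCoeff lam (insert v F) ≤ 0)

/-- The `(k-1)`-skeleton of `∂P` and `𝒱_k(P)` determine `∂P`: every simplicial `d`-polytope with the
same `(k-1)`-skeleton and the same set of sign vectors has the same boundary complex. -/
def IsDetermined (P : SimplicialPolytope d V) (k : ℕ) : Prop :=
  ∀ Q : SimplicialPolytope d V, skel k Q.boundary = skel k P.boundary →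
    Q.signVectors k = P.signVectors k → Q.boundary = P.boundary

end SimplicialPolytope

end StressRec

end

/-! Homogenize: write `P.homog v` for the vector `(p v, 1)`. The faces of `∂P` become the label sets
of the proper faces of a pointed cone in `ℝ^(d+1)`, and each face has linearly independent
generators (`boundary_eq_coneFaces`, `linearIndepOn_homog`). It suffices that no missing face `M` of
`∂P` is a face of `∂Q`. Indeed, every nonface of `∂P` contains a missing face and `∂Q` is closed
under subsets, so then `∂Q ⊆ ∂P`; and a boundary sphere contained in another one of the same
dimension equals it (`coneFaces_eq_of_subset`).

If `|M| ≤ k`, the common skeleton decides. If `k < |M| ≤ d + 1 - k`, equality of the sign vectors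
yields a stress on `Q` with the signs prescribed around `F`. Its equations, read at the monomial of
`F`, give a linear relation between the vertices of `Q`. Were `M` a face of `∂Q`, a supporting
functional would force all coefficients off `M` to vanish, leaving a nontrivial dependence on a face
(`notMem_boundary_of_stress`).

If `|M| > d + 1 - k`, a mod 2 linking argument applies (`notMem_coneFaces_of_missing_of_large`). For
`N = M \ {w}` the link of `N` in `∂P` carries a cycle `z` on faces with `d + 1 - |M| < k` elements,
which are also faces of `∂Q`. If `M` were a face of `∂Q`, the faces of `∂Q` avoiding `M` would form
an acyclic complex, so `z` would bound there a chain of faces with at most `k` elements, which are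
again faces of `∂P`. Modulo the span of `M` their cones miss the origin, so a generic ray crosses
`z` an even number of times; yet the link of `N` is crossed exactly once.

Two tools replace general topology: acyclicity of half-links (`isAcyclic_posLink`) and a parity
lemma on nonnegative functions (`even_card_zeros_of_two_le_finrank`), which gives both the evenness
at ridges and the ray-crossing parity. -/

namespace StressRec

/-! ### Chains modulo two -/

section Chains

variable {V : Type*} [Fintype V] [DecidableEq V]

/-- The augmented simplicial boundary of a mod 2 chain on the finite subsets of `V`. -/
def bdry (c : Finset V → ZMod 2) (G : Finset V) : ZMod 2 := ∑ v ∈ Gᶜ, c (insert v G)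

/-- The cone with apex `v` over a chain. -/
def coneOver (v : V) (c : Finset V → ZMod 2) (G : Finset V) : ZMod 2 :=
  if v ∈ G then c (G.erase v) else 0

/-- Every mod 2 cycle in `K` is the boundary of a chain in `K`. -/
def IsAcyclic (K : Set (Finset V)) : Prop :=
  ∀ z : Finset V → ZMod 2, (∀ G, z G ≠ 0 → G ∈ K) → bdry z = 0 →
    ∃ c : Finset V → ZMod 2, (∀ G, c G ≠ 0 → G ∈ K) ∧ bdry c = z

lemma bdry_add (a b : Finset V → ZMod 2) : bdry (a + b) = bdry a + bdry b := by
  ext G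
  simp [bdry, Finset.sum_add_distrib]

/-- Coning is a chain homotopy from the identity to zero on chains avoiding the apex; mod 2 no signs
appear. -/
lemma bdry_coneOver (v : V) (c : Finset V → ZMod 2) (hc : ∀ G, v ∈ G → c G = 0) :
    bdry (coneOver v c) = c + coneOver v (bdry c) := by
  ext G
  by_cases hv : v ∈ G
  · have h1 : (G.erase v)ᶜ = insert v Gᶜ := by
      ext u; by_cases h : u = v <;> simp [h]
    have h2 : v ∉ Gᶜ := by simpa using hv
    simp only [bdry, coneOver, Pi.add_apply, hv, if_true, h1, Finset.sum_insert h2,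
      Finset.insert_erase hv, hc G hv, zero_add]
    refine Finset.sum_congr rfl fun u hu => ?_
    have huv : u ≠ v := by rintro rfl; exact h2 hu
    simp [hv, Finset.erase_insert_of_ne huv]
  · have h2 : v ∈ Gᶜ := by simpa using hv
    simp only [bdry, coneOver, Pi.add_apply, hv, if_false, add_zero]
    rw [Finset.sum_eq_single_of_mem v h2]
    · simp [hv]
    · intro u _ huv
      simp [hv, huv.symm]

lemma zmod_two_add_self (a : ZMod 2) : a + a = 0 := CharTwo.add_self_eq_zero a

/-- A complex is acyclic if the link and the deletion of one of its vertices are. -/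
lemma IsAcyclic.of_link_del {K : Set (Finset V)} (v : V)
    (hK : ∀ G, insert v G ∈ K → G ∈ K)
    (hlink : IsAcyclic {G | v ∉ G ∧ insert v G ∈ K})
    (hdel : IsAcyclic {G | v ∉ G ∧ G ∈ K}) : IsAcyclic K := by
  intro z hz hbz
  set y : Finset V → ZMod 2 := fun G => if v ∈ G then 0 else z (insert v G) with hy
  have hyv : ∀ G, v ∈ G → y G = 0 := fun G h => by simp [hy, h]
  have hby : bdry y = 0 := by
    ext G
    by_cases hv : v ∈ G
    · simp [bdry, hy, hv]
    · have h1 : Gᶜ = insert v (insert v G)ᶜ := by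
        ext u; by_cases h : u = v <;> simp [h, hv]
      have h2 := congrFun hbz (insert v G)
      simp only [bdry, Pi.zero_apply] at h2 ⊢
      rw [h1, Finset.sum_insert (by simp), hyv _ (by simp), zero_add, ← h2]
      refine Finset.sum_congr rfl fun u hu => ?_
      have huv : v ≠ u := by rintro rfl; simp at hu
      simp [hy, hv, huv, Finset.insert_comm]
  obtain ⟨c, hc, hbc⟩ := hlink y (by
    intro G hG
    have hv : v ∉ G := fun h => hG (hyv G h)
    exact ⟨hv, hz _ (by simpa [hy, hv] using hG)⟩) hby
  have hcv : ∀ G, v ∈ G → c G = 0 := fun G h => by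
    by_contra h'
    exact (hc G h').1 h
  -- The added term is the boundary of the cone over `c`, so `z'` is homologous to `z`; it cancels
  -- every simplex of `z` through `v`.
  set z' := z + (c + coneOver v y) with hz'
  have hz'v : ∀ G, v ∈ G → z' G = 0 := fun G h => by
    simp [hz', hcv G h, coneOver, h, hy, Finset.insert_erase h, zmod_two_add_self]
  have hbz' : bdry z' = 0 := by
    rw [hz', bdry_add, bdry_add, hbz, hbc, bdry_coneOver v y hyv, hby]
    ext G
    simp [coneOver, zmod_two_add_self]
  obtain ⟨c', hc', hbc'⟩ := hdel z' (by
    intro G hG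
    have hv : v ∉ G := fun h => hG (hz'v G h)
    refine ⟨hv, ?_⟩
    by_cases h1 : z G = 0
    · have h2 : c G ≠ 0 := by simpa [hz', h1, coneOver, hv] using hG
      exact hK G (hc G h2).2
    · exact hz G h1) hbz'
  refine ⟨c' + coneOver v c, ?_, ?_⟩
  · intro G hG
    by_cases h1 : c' G = 0
    · have h2 : coneOver v c G ≠ 0 := by simpa [h1] using hG
      by_cases hv : v ∈ G
      · have h3 : c (G.erase v) ≠ 0 := by simpa [coneOver, hv] using h2
        simpa [Finset.insert_erase hv] using (hc _ h3).2
      · simp [coneOver, hv] at h2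
    · exact (hc' G h1).2
  · rw [bdry_add, hbc', bdry_coneOver v c hcv, hbc, hz']
    ext G
    simp only [Pi.add_apply]
    rw [add_assoc, zmod_two_add_self, add_zero]

/-- The augmented boundary at `∅` reads off the coefficient of `{v}`, so a cycle lives on `∅` alone
and is filled by its cone. -/
lemma isAcyclic_of_subsingleton {K : Set (Finset V)} (v : V) (hv : {v} ∈ K)
    (hK : ∀ G ∈ K, G ⊆ {v}) : IsAcyclic K := by
  intro z hz hbz
  have h0 : ∀ G, v ∈ G → z G = 0 := by
    intro G hvG
    by_contra h
    have hG : G = {v} :=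
      (hK G (hz G h)).antisymm (by simpa using hvG)
    have h2 := congrFun hbz ∅
    simp only [bdry, Pi.zero_apply] at h2
    rw [Finset.sum_eq_single_of_mem v (by simp)] at h2
    · exact h (by simpa [hG] using h2)
    · intro u _ huv
      by_contra h'
      exact huv (by simpa using hK _ (hz _ h'))
  refine ⟨coneOver v z, ?_, ?_⟩
  · intro G hG
    by_cases hvG : v ∈ G
    · have h1 : z (G.erase v) ≠ 0 := by simpa [coneOver, hvG] using hG
      have h2 := hK _ (hz _ h1)
      have h3 : G = {v} := by
        rw [← Finset.insert_erase hvG]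
        ext u
        constructor
        · intro hu
          rcases Finset.mem_insert.1 hu with h | h
          · simp [h]
          · exact h2 h
        · intro hu
          simp [Finset.mem_singleton.1 hu]
      rwa [h3]
    · simp [coneOver, hvG] at hG
  · rw [bdry_coneOver v z h0, hbz]
    ext G
    simp [coneOver]

/-- Summation by parts: boundary and coboundary are adjoint. -/
lemma sum_mul_bdry (φ c : Finset V → ZMod 2) :
    ∑ G, φ G * bdry c G = ∑ H, c H * ∑ v ∈ H, φ (H.erase v) := by
  simp only [bdry, Finset.mul_sum]
  rw [Finset.sum_sigma', Finset.sum_sigma']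
  refine Finset.sum_bij' (fun a _ => ⟨insert a.2 a.1, a.2⟩) (fun a _ => ⟨a.1.erase a.2, a.2⟩)
    ?_ ?_ ?_ ?_ ?_
  · simp
  · simp
  · rintro ⟨G, v⟩ h
    have : v ∉ G := by simpa using h
    simp [Finset.erase_insert this]
  · rintro ⟨G, v⟩ h
    have : v ∈ G := by simpa using h
    simp [Finset.insert_erase this]
  · rintro ⟨G, v⟩ h
    have : v ∉ G := by simpa using h
    simp [Finset.erase_insert this, mul_comm]

end Chains

/-! ### Nonnegative functions in a subspace -/

/-- The perturbation device: a functional can be tilted slightly without losing any of its finitely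
many strict inequalities. -/
lemma exists_pos_forall_add_mul_pos {ι : Type*} [Finite ι] (a b : ι → ℝ) :
    ∃ ε > 0, ∀ i, 0 < a i → 0 < a i + ε * b i := by
  have h : ∀ᶠ ε in nhdsWithin (0 : ℝ) (Set.Ioi 0), ∀ i, 0 < a i → 0 < a i + ε * b i := by
    rw [Filter.eventually_all]
    intro i
    by_cases hi : 0 < a i
    · have hc : Continuous fun ε : ℝ => a i + ε * b i := by fun_prop
      have : ∀ᶠ ε in nhds (0 : ℝ), 0 < a i + ε * b i :=
        hc.continuousAt.eventually (lt_mem_nhds (by simpa using hi))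
      exact (this.filter_mono nhdsWithin_le_nhds).mono fun _ h _ => h
    · exact Filter.Eventually.of_forall fun _ h => absurd h hi
  obtain ⟨ε, h1, h2⟩ := (h.and self_mem_nhdsWithin).exists
  exact ⟨ε, h2, h1⟩

/-- Rotating a nonnegative function `f` in the direction `-g` until a new zero appears. -/
lemma exists_sub_smul_nonneg {ι : Type*} [Finite ι] (f g : ι → ℝ) (hf : 0 ≤ f)
    (hg : ∃ i, 0 < g i) :
    ∃ t : ℝ, 0 ≤ f - t • g ∧ ∃ i, 0 < g i ∧ f i = t * g i := by
  have : Fintype ι := Fintype.ofFinite ι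
  classical
  obtain ⟨i, hi, hmin⟩ := (Finset.univ.filter fun i => 0 < g i).exists_min_image
    (fun i => f i / g i) (by obtain ⟨i, hi⟩ := hg; exact ⟨i, by simpa using hi⟩)
  have hi : 0 < g i := by simpa using hi
  refine ⟨f i / g i, fun j => ?_, i, hi, by field_simp⟩
  have h0 : 0 ≤ f i / g i := div_nonneg (hf i) hi.le
  simp only [Pi.zero_apply, Pi.sub_apply, Pi.smul_apply, smul_eq_mul, sub_nonneg]
  by_cases hj : 0 < g j
  · exact (le_div_iff₀ hj).1 (hmin j (by simpa using hj))
  · exact (mul_nonpos_of_nonneg_of_nonpos h0 (not_lt.1 hj)).trans (hf j)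

/-- In a space of functions of dimension at least two all of whose nonzero nonnegative members
have at most one zero, the number of points at which some such member vanishes is even. -/
lemma even_card_zeros_of_two_le_finrank {ι : Type*} [Fintype ι] [DecidableEq ι]
    (S : Submodule ℝ (ι → ℝ))
    (hS : 2 ≤ Module.finrank ℝ S)
    (h1 : ∀ f ∈ S, f ≠ 0 → 0 ≤ f → ∀ i j, f i = 0 → f j = 0 → i = j)
    (A : Finset ι) (hA : ∀ i, i ∈ A ↔ ∃ f ∈ S, f ≠ 0 ∧ 0 ≤ f ∧ f i = 0) : Even A.card := by
  rcases A.eq_empty_or_nonempty with rfl | ⟨i, hi⟩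
  · simp
  obtain ⟨f, hfS, hf0, hf, hfi⟩ := (hA i).1 hi
  have hpos : ∀ j, j ≠ i → 0 < f j := fun j hj =>
    (hf j).lt_of_ne fun h => hj (h1 f hfS hf0 hf j i h.symm hfi)
  -- Rotating `f` along `g` keeps the zero at `i` and creates another one, which is allowed only if
  -- the result is `0`. Hence the members vanishing at `i` form the line of `f`.
  have key : ∀ g ∈ S, g i = 0 → ∃ a : ℝ, g = a • f := by
    have aux : ∀ g ∈ S, g i = 0 → (∃ j, 0 < g j) → ∃ a : ℝ, g = a • f := by
      intro g hg hgi hj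
      obtain ⟨t, ht, j, hj, hjt⟩ := exists_sub_smul_nonneg f g hf hj
      have hji : j ≠ i := by rintro rfl; simp [hgi] at hj
      have h2 : f - t • g = 0 := by
        by_contra h
        exact hji (h1 _ (S.sub_mem hfS (S.smul_mem t hg)) h ht j i (by simp [hjt])
          (by simp [hfi, hgi]))
      have ht0 : t ≠ 0 := by
        rintro rfl
        exact hf0 (by simpa using h2)
      refine ⟨t⁻¹, ?_⟩
      rw [sub_eq_zero.1 h2, smul_smul, inv_mul_cancel₀ ht0, one_smul]
    intro g hg hgi
    by_cases hj : ∃ j, 0 < g j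
    · exact aux g hg hgi hj
    by_cases hj' : ∃ j, 0 < (-g) j
    · obtain ⟨a, ha⟩ := aux (-g) (S.neg_mem hg) (by simp [hgi]) hj'
      exact ⟨-a, by rw [neg_smul, ← ha, neg_neg]⟩
    · push Not at hj hj'
      refine ⟨0, ?_⟩
      ext j
      have h3 := hj' j
      simp only [Pi.neg_apply] at h3
      simpa using le_antisymm (hj j) (by linarith)
  obtain ⟨g, hgS, hgi⟩ : ∃ g ∈ S, 0 < g i := by
    by_contra! hcon
    have hle : S ≤ Submodule.span ℝ {f} := by
      intro g hg
      have h2 := hcon g hg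
      have h3 := hcon (-g) (S.neg_mem hg)
      simp only [Pi.neg_apply] at h3
      obtain ⟨a, rfl⟩ := key g hg (by linarith)
      exact Submodule.smul_mem _ _ (Submodule.mem_span_singleton_self f)
    have := Submodule.finrank_mono hle
    have := finrank_span_singleton (K := ℝ) hf0
    omega
  obtain ⟨j₀, hj₀⟩ : ∃ j, j ≠ i := by
    by_contra! hcon
    exact hf0 (funext fun j => by rw [hcon j, hfi]; rfl)
  obtain ⟨j, hj, hmax⟩ := (Finset.univ.erase i).exists_max_image (fun j => -g j / f j)
    ⟨j₀, by simpa using hj₀⟩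
  have hji : j ≠ i := by simpa using hj
  -- The largest ratio is the least multiple of `f` that makes `g` nonnegative off `i`. The result
  -- `f₂` spans the other extreme ray of the nonnegative cone in `S`, with its zero at `j`.
  set t := -g j / f j with ht
  set f₂ := g + t • f with hf₂
  have hf₂S : f₂ ∈ S := S.add_mem hgS (S.smul_mem t hfS)
  have hf₂i : 0 < f₂ i := by simp [hf₂, hfi, hgi]
  have hf₂0 : f₂ ≠ 0 := fun h => by simp [h] at hf₂i
  have hf₂j : f₂ j = 0 := by
    have := (hpos j hji).ne'
    simp only [hf₂, ht, Pi.add_apply, Pi.smul_apply, smul_eq_mul]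
    field_simp
    ring
  have hf₂n : 0 ≤ f₂ := by
    intro a
    by_cases ha : a = i
    · rw [ha]; exact hf₂i.le
    · have h2 := hmax a (by simpa using ha)
      have h3 := (div_le_iff₀ (hpos a ha)).1 h2
      simp only [hf₂, Pi.zero_apply, Pi.add_apply, Pi.smul_apply, smul_eq_mul]
      linarith
  have hAeq : A = {i, j} := by
    ext a
    simp only [Finset.mem_insert, Finset.mem_singleton]
    constructor
    · intro ha
      obtain ⟨f₃, hf₃S, hf₃0, hf₃, hf₃a⟩ := (hA a).1 ha
      set b := f₃ i / f₂ i with hb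
      have hb0 : 0 ≤ b := div_nonneg (hf₃ i) hf₂i.le
      obtain ⟨s, hs⟩ := key (f₃ - b • f₂) (S.sub_mem hf₃S (S.smul_mem b hf₂S)) (by
        simp only [hb, Pi.sub_apply, Pi.smul_apply, smul_eq_mul]
        field_simp
        ring)
      have heq : ∀ x, f₃ x = b * f₂ x + s * f x := fun x => by
        have := congrFun hs x
        simp only [Pi.sub_apply, Pi.smul_apply, smul_eq_mul] at this
        linarith
      have hs0 : 0 ≤ s := by
        have h2 : 0 ≤ f₃ j := hf₃ j
        rw [heq j, hf₂j, mul_zero, zero_add] at h2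
        exact nonneg_of_mul_nonneg_left h2 (hpos j hji)
      have h2 := heq a
      rw [hf₃a] at h2
      have h3 : 0 ≤ b * f₂ a := mul_nonneg hb0 (hf₂n a)
      have h4 : 0 ≤ s * f a := mul_nonneg hs0 (hf a)
      have h5 : b * f₂ a = 0 := by linarith
      have h6 : s * f a = 0 := by linarith
      by_cases hai : a = i
      · exact Or.inl hai
      · right
        have hs' : s = 0 := (mul_eq_zero.1 h6).resolve_right (hpos a hai).ne'
        have hb' : b ≠ 0 := by
          rintro hb'
          exact hf₃0 (funext fun x => by rw [heq x, hb', hs']; simp)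
        exact h1 f₂ hf₂S hf₂0 hf₂n a j ((mul_eq_zero.1 h5).resolve_left hb') hf₂j
    · rintro (rfl | rfl)
      · exact hi
      · exact (hA _).2 ⟨f₂, hf₂S, hf₂0, hf₂n, hf₂j⟩
  rw [hAeq, Finset.card_pair hji.symm]
  exact even_two

/-! ### Faces of pointed polyhedral cones -/

section ConeFaces

variable {V X : Type*} [AddCommGroup X] [Module ℝ X] {x : V → X}

variable [Fintype V] in
/-- The proper faces of the cone generated by the vectors `x v`, recorded by the labels of the
generators that they contain. -/
def coneFaces (x : V → X) : Set (Finset V) :=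
  {W | W ≠ Finset.univ ∧
    ∃ f : Module.Dual ℝ X, ∀ v, 0 ≤ f (x v) ∧ (f (x v) = 0 ↔ v ∈ W)}

lemma pos_of_supporting {W : Finset V} {f : Module.Dual ℝ X}
    (hf : ∀ v, 0 ≤ f (x v) ∧ (f (x v) = 0 ↔ v ∈ W)) {v : V} (hv : v ∉ W) : 0 < f (x v) :=
  (hf v).1.lt_of_ne fun h => hv ((hf v).2.1 h.symm)

lemma exists_dual_eq {ι : Type*} {w : ι → X} (hw : LinearIndependent ℝ w) (c : ι → ℝ) :
    ∃ h : Module.Dual ℝ X, ∀ i, h (w i) = c i := by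
  obtain ⟨h, hh⟩ := LinearMap.exists_extend ((Module.Basis.span hw).constr ℝ c)
  refine ⟨h, fun i => ?_⟩
  have h1 := LinearMap.congr_fun hh (Module.Basis.span hw i)
  rw [Module.Basis.constr_basis] at h1
  rw [← h1]
  simp [Module.Basis.span_apply]

lemma dual_eq_zero_of_span (hx : Submodule.span ℝ (Set.range x) = ⊤) {f : Module.Dual ℝ X}
    (hf : ∀ v, f (x v) = 0) : f = 0 :=
  LinearMap.ext_on_range hx (by simpa using hf)

lemma exists_annihilator [FiniteDimensional ℝ X] (W : Finset V) :
    ∃ T : Submodule ℝ (X →ₗ[ℝ] ℝ), (∀ g, g ∈ T ↔ ∀ v ∈ W, g (x v) = 0) ∧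
      Module.finrank ℝ X = Module.finrank ℝ (Submodule.span ℝ (x '' (W : Set V))) +
        Module.finrank ℝ T := by
  refine ⟨(Submodule.span ℝ (x '' (W : Set V))).dualAnnihilator, fun g => ?_,
    (Subspace.finrank_add_finrank_dualAnnihilator_eq _).symm⟩
  rw [Submodule.mem_dualAnnihilator]
  constructor
  · intro h v hv
    exact h _ (Submodule.subset_span ⟨v, hv, rfl⟩)
  · intro h w hw
    have : Submodule.span ℝ (x '' (W : Set V)) ≤ LinearMap.ker g := by
      rw [Submodule.span_le]
      rintro _ ⟨v, hv, rfl⟩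
      exact h v hv
    exact this hw

lemma finrank_span_image_eq_card {W : Finset V} (hW : LinearIndepOn ℝ x (W : Set V)) :
    Module.finrank ℝ (Submodule.span ℝ (x '' (W : Set V))) = W.card := by
  rw [Set.image_eq_range]
  simpa using finrank_span_eq_card hW

variable [Fintype V]

lemma supporting_ne_zero {W : Finset V} (hW : W ≠ Finset.univ) {f : Module.Dual ℝ X}
    (hf : ∀ v, 0 ≤ f (x v) ∧ (f (x v) = 0 ↔ v ∈ W)) : f ≠ 0 := by
  rintro rfl
  exact hW (Finset.eq_univ_iff_forall.2 fun v => (hf v).2.1 rfl)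

lemma exists_mem_coneFaces_of_nonneg (hx : Submodule.span ℝ (Set.range x) = ⊤)
    {f : Module.Dual ℝ X} (hf : ∀ v, 0 ≤ f (x v)) (hf0 : f ≠ 0) :
    ∃ W ∈ coneFaces x, ∀ v, f (x v) = 0 ↔ v ∈ W := by
  classical
  refine ⟨Finset.univ.filter fun v => f (x v) = 0, ⟨fun h => hf0 ?_, f, fun v => ?_⟩, by simp⟩
  · exact dual_eq_zero_of_span hx fun v => by
      simpa using Finset.eq_univ_iff_forall.1 h v
  · simpa using hf v

/-- A face that does not span a hyperplane is properly contained in another face. -/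
lemma exists_ssuperset_mem_coneFaces [FiniteDimensional ℝ X]
    (hx : Submodule.span ℝ (Set.range x) = ⊤) {W : Finset V} (hW : W ∈ coneFaces x)
    (hr : Module.finrank ℝ (Submodule.span ℝ (x '' W)) + 1 < Module.finrank ℝ X) :
    ∃ W' ∈ coneFaces x, W ⊂ W' := by
  obtain ⟨hWu, f, hf⟩ := hW
  obtain ⟨S, hSmem, hSr⟩ := exists_annihilator (x := x) W
  have hf0 := supporting_ne_zero hWu hf
  -- The annihilator of `W` has dimension at least two, so the supporting functional can be rotated
  -- about `W` until it meets a new generator.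
  obtain ⟨g, hgS, hgf⟩ : ∃ g ∈ S, g ∉ Submodule.span ℝ {f} := by
    by_contra! hcon
    have h1 := (Submodule.finrank_mono (show S ≤ Submodule.span ℝ {f} from hcon)).trans
      (finrank_span_singleton (K := ℝ) hf0).le
    omega
  have main : ∀ g ∈ S, g ∉ Submodule.span ℝ {f} → (∃ v, 0 < g (x v)) →
      ∃ W' ∈ coneFaces x, W ⊂ W' := by
    intro g hgS hgf hpos
    obtain ⟨t, ht, v, hv, hvt⟩ := exists_sub_smul_nonneg (fun v => f (x v)) (fun v => g (x v))
      (fun v => (hf v).1) hpos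
    have hne : f - t • g ≠ 0 := by
      intro h
      have ht0 : t ≠ 0 := by
        rintro rfl
        exact hf0 (by simpa using h)
      apply hgf
      rw [Submodule.mem_span_singleton]
      exact ⟨t⁻¹, by rw [sub_eq_zero.1 h, smul_smul, inv_mul_cancel₀ ht0, one_smul]⟩
    obtain ⟨W', hW', hW'f⟩ := exists_mem_coneFaces_of_nonneg hx (f := f - t • g)
      (fun v => by simpa using ht v) hne
    refine ⟨W', hW', Finset.ssubset_iff_subset_ne.2 ⟨fun u hu => ?_, ?_⟩⟩
    · rw [← hW'f]
      simp [(hf u).2.2 hu, (hSmem g).1 hgS u hu]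
    · rintro rfl
      have h1 : v ∈ W := (hW'f v).1 (by simp [hvt])
      exact hv.ne' ((hSmem g).1 hgS v h1)
  by_cases hpos : ∃ v, 0 < g (x v)
  · exact main g hgS hgf hpos
  · refine main (-g) (S.neg_mem hgS) (fun h => hgf (by simpa using Submodule.neg_mem _ h)) ?_
    by_contra! hcon
    push Not at hpos
    refine hgf ?_
    rw [dual_eq_zero_of_span hx (f := g) fun v => ?_]
    · exact Submodule.zero_mem _
    · have := hcon v
      simp only [LinearMap.neg_apply] at this
      linarith [hpos v]

variable (hs : ∀ W ∈ coneFaces x, LinearIndepOn ℝ x (W : Set V))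

-- By independence some functional is `0` on `G` and `1` on the rest of `W`; a small multiple of it,
-- added to a supporting functional of `W`, cuts the face down to `G`.
include hs in
lemma coneFaces_mono {W G : Finset V} (hW : W ∈ coneFaces x) (hG : G ⊆ W) :
    G ∈ coneFaces x := by
  classical
  have hli := hs W hW
  obtain ⟨hWu, f, hf⟩ := hW
  obtain ⟨h, hh⟩ := exists_dual_eq hli fun i => if (i : V) ∈ G then 0 else 1
  have hh' : ∀ v ∈ W, h (x v) = if v ∈ G then 0 else 1 := fun v hv => hh ⟨v, hv⟩
  obtain ⟨ε, hε, hpos⟩ := exists_pos_forall_add_mul_pos (fun v => f (x v)) (fun v => h (x v))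
  have hGu : G ≠ Finset.univ := fun h => hWu (Finset.univ_subset_iff.1 (h ▸ hG))
  refine ⟨hGu, f + ε • h, fun v => ?_⟩
  simp only [LinearMap.add_apply, LinearMap.smul_apply, smul_eq_mul]
  by_cases hv : v ∈ W
  · rw [(hf v).2.2 hv, hh' v hv]
    by_cases hvG : v ∈ G
    · simp [hvG]
    · simp [hvG, hε.le, hε.ne']
  · have h1 := hpos v (pos_of_supporting hf hv)
    exact ⟨h1.le, fun h => absurd h h1.ne', fun h => absurd (hG h) hv⟩

include hs in
lemma card_add_one_le_of_mem_coneFaces [FiniteDimensional ℝ X] {W : Finset V}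
    (hW : W ∈ coneFaces x) : W.card + 1 ≤ Module.finrank ℝ X := by
  have hli := hs W hW
  obtain ⟨hWu, f, hf⟩ := hW
  obtain ⟨v, hv⟩ : ∃ v, v ∉ W := by
    by_contra! h
    exact hWu (Finset.eq_univ_iff_forall.2 h)
  have hlt : Submodule.span ℝ (x '' (W : Set V)) < ⊤ := by
    refine lt_of_le_of_lt (b := LinearMap.ker f) ?_ ?_
    · rw [Submodule.span_le]
      rintro _ ⟨u, hu, rfl⟩
      exact (hf u).2.2 hu
    · rw [lt_top_iff_ne_top]
      intro h
      have : x v ∈ LinearMap.ker f := h ▸ Submodule.mem_top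
      exact hv ((hf v).2.1 this)
  have h1 := Submodule.finrank_lt hlt.ne
  have h2 : Module.finrank ℝ (Submodule.span ℝ (x '' (W : Set V))) = W.card :=
    finrank_span_image_eq_card hli
  omega

-- A face of maximal cardinality above `W` must span a hyperplane, since otherwise it could be
-- enlarged.
include hs in
lemma exists_facet_superset [FiniteDimensional ℝ X]
    (hx : Submodule.span ℝ (Set.range x) = ⊤) {W : Finset V} (hW : W ∈ coneFaces x) :
    ∃ B ∈ coneFaces x, W ⊆ B ∧ B.card + 1 = Module.finrank ℝ X := by
  obtain ⟨B, ⟨hB, hWB⟩, hmax⟩ := (Set.toFinite {B | B ∈ coneFaces x ∧ W ⊆ B}).exists_maximalFor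
    Finset.card _ ⟨W, hW, subset_rfl⟩
  refine ⟨B, hB, hWB, ?_⟩
  by_contra hne
  have h1 := card_add_one_le_of_mem_coneFaces hs hB
  have h2 : Module.finrank ℝ (Submodule.span ℝ (x '' (B : Set V))) = B.card :=
    finrank_span_image_eq_card (hs B hB)
  obtain ⟨B', hB', hBB'⟩ := exists_ssuperset_mem_coneFaces hx hB (by omega)
  have h3 := hmax ⟨hB', hWB.trans hBB'.1⟩ (Finset.card_lt_card hBB').le
  exact absurd (Finset.card_lt_card hBB') (not_lt.2 h3)

variable [DecidableEq V]

include hs in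
/-- Every ridge lies in an even number of facets. -/
lemma even_card_facets_of_ridge [FiniteDimensional ℝ X]
    (hx : Submodule.span ℝ (Set.range x) = ⊤) {R : Finset V}
    (hRc : R.card + 2 = Module.finrank ℝ X) (A : Finset V)
    (hA : ∀ v, v ∈ A ↔ v ∉ R ∧ insert v R ∈ coneFaces x) : Even A.card := by
  obtain ⟨T, hTmem, hTr⟩ := exists_annihilator (x := x) R
  have hTr : 2 ≤ Module.finrank ℝ T := by
    have h2 : Module.finrank ℝ (Submodule.span ℝ (x '' (R : Set V))) ≤ R.card := by
      classical
      have := finrank_span_finset_le_card (R := ℝ) (R.image x)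
      rw [Finset.coe_image] at this
      exact this.trans Finset.card_image_le
    omega
  -- Functionals vanishing on `R` are viewed as functions on the other labels. A nonzero nonnegative
  -- one supports a face containing `R`, and two zeros would give a face with too many elements.
  let ev : T →ₗ[ℝ] ({v // v ∉ R} → ℝ) :=
    LinearMap.pi fun v => (Module.Dual.eval ℝ X (x v)).comp T.subtype
  have hinj : Function.Injective ev := by
    intro g g' hg
    refine Subtype.ext (LinearMap.ext_on_range hx fun v => ?_)
    by_cases hv : v ∈ R
    · rw [(hTmem g).1 g.2 v hv, (hTmem g').1 g'.2 v hv]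
    · exact congrFun hg ⟨v, hv⟩
  have hsup : ∀ g : T, ev g ≠ 0 → 0 ≤ ev g →
      ∃ W ∈ coneFaces x, R ⊆ W ∧ ∀ v, g.1 (x v) = 0 ↔ v ∈ W := by
    intro g hg0 hg
    obtain ⟨W, hW, hgW⟩ := exists_mem_coneFaces_of_nonneg hx (f := g.1) (fun v => by
      by_cases hv : v ∈ R
      · exact ((hTmem g).1 g.2 v hv).ge
      · exact hg ⟨v, hv⟩) (by
      intro h
      exact hg0 (by rw [show g = 0 from Subtype.ext h, map_zero]))
    exact ⟨W, hW, fun v hv => (hgW v).1 ((hTmem g).1 g.2 v hv), hgW⟩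
  have hcard : A.card = (A.subtype fun v => v ∉ R).card := by
    rw [← Finset.card_map (Function.Embedding.subtype _), Finset.subtype_map_of_mem]
    intro v hv
    exact ((hA v).1 hv).1
  rw [hcard]
  refine even_card_zeros_of_two_le_finrank (LinearMap.range ev)
    (by rwa [LinearMap.finrank_range_of_inj hinj]) ?_ _ ?_
  · rintro _ ⟨g, rfl⟩ hg0 hg i j hi hj
    obtain ⟨W, hW, hRW, hgW⟩ := hsup g hg0 hg
    by_contra hij
    have h1 : insert i.1 (insert j.1 R) ⊆ W := by
      simp only [Finset.insert_subset_iff]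
      exact ⟨(hgW i).1 hi, (hgW j).1 hj, hRW⟩
    have h2 := Finset.card_le_card h1
    rw [Finset.card_insert_of_notMem, Finset.card_insert_of_notMem j.2] at h2
    · have := card_add_one_le_of_mem_coneFaces hs hW
      omega
    · simp only [Finset.mem_insert, not_or]
      exact ⟨fun h => hij (Subtype.ext h), i.2⟩
  · rintro ⟨v, hv⟩
    simp only [Finset.mem_subtype, hA]
    constructor
    · rintro ⟨-, hvu, f, hf⟩
      refine ⟨_, ⟨⟨f, (hTmem f).2 fun u hu => (hf u).2.2 (by simp [hu])⟩, rfl⟩, ?_, ?_, ?_⟩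
      · intro h
        refine supporting_ne_zero hvu hf ?_
        have : (⟨f, _⟩ : T) = 0 := hinj (h.trans (map_zero ev).symm)
        exact congrArg Subtype.val this
      · intro u
        exact (hf u).1
      · exact (hf v).2.2 (by simp)
    · rintro ⟨_, ⟨g, rfl⟩, hg0, hg, hgv⟩
      obtain ⟨W, hW, hRW, hgW⟩ := hsup g hg0 hg
      refine ⟨hv, ?_⟩
      refine coneFaces_mono hs hW ?_
      rw [Finset.insert_subset_iff]
      exact ⟨(hgW v).1 hgv, hRW⟩

include hs in
/-- A face has a neighbour on the positive side of a functional that vanishes on it and changes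
sign. -/
lemma exists_pos_insert_mem_coneFaces {F : Finset V} (hF : F ∈ coneFaces x)
    (hx : Submodule.span ℝ (Set.range x) = ⊤)
    {l : Module.Dual ℝ X} (hl : ∀ v ∈ F, l (x v) = 0) (hneg : ∃ v, l (x v) < 0)
    (hpos : ∃ v, 0 < l (x v)) : ∃ v, insert v F ∈ coneFaces x ∧ 0 < l (x v) := by
  obtain ⟨hFu, b, hb⟩ := hF
  obtain ⟨t, ht, v, hv, hvt⟩ := exists_sub_smul_nonneg (fun v => b (x v)) (fun v => l (x v))
    (fun v => (hb v).1) hpos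
  have hne : b - t • l ≠ 0 := by
    obtain ⟨w, hw⟩ := hneg
    have hwF : w ∉ F := fun h => hw.ne (hl w h)
    have h1 := pos_of_supporting hb hwF
    have hvF : v ∉ F := fun h => hv.ne' (hl v h)
    have h2 := pos_of_supporting hb hvF
    have ht0 : 0 < t := by
      by_contra! h
      have := mul_nonpos_of_nonpos_of_nonneg h hv.le
      linarith
    intro h
    have h3 := LinearMap.congr_fun h (x w)
    simp only [LinearMap.sub_apply, LinearMap.smul_apply, smul_eq_mul, LinearMap.zero_apply] at h3
    nlinarith
  obtain ⟨W, hW, hgW⟩ := exists_mem_coneFaces_of_nonneg hx (f := b - t • l)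
    (fun v => by simpa using ht v) hne
  refine ⟨v, coneFaces_mono hs hW ?_, hv⟩
  rw [Finset.insert_subset_iff]
  exact ⟨(hgW v).1 (by simp [hvt]), fun u hu => (hgW u).1 (by simp [(hb u).2.2 hu, hl u hu])⟩

end ConeFaces

/-! ### Acyclicity of half-links, and link cycles mod 2 -/

section Acyclic

variable {V X : Type*} [Fintype V] [DecidableEq V] [AddCommGroup X] [Module ℝ X] {x : V → X}
  (hs : ∀ W ∈ coneFaces x, LinearIndepOn ℝ x (W : Set V))

/-- The part of the link of `F` in the open half-space `l > 0`. -/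
def posLink (x : V → X) (F : Finset V) (l : Module.Dual ℝ X) : Set (Finset V) :=
  {G | G ∪ F ∈ coneFaces x ∧ ∀ v ∈ G, 0 < l (x v)}

include hs in
/-- The part of the link of a face in an open half-space is acyclic, unless it is empty or the
whole link. -/
theorem isAcyclic_posLink (hx : Submodule.span ℝ (Set.range x) = ⊤) {F : Finset V}
    (hF : F ∈ coneFaces x) {l : Module.Dual ℝ X} (hl : ∀ v ∈ F, l (x v) = 0)
    (hneg : ∃ v, l (x v) < 0) (hpos : ∃ v, 0 < l (x v)) : IsAcyclic (posLink x F l) := by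
  classical
  obtain ⟨n, hn⟩ : ∃ n, (Finset.univ.filter fun v =>
    insert v F ∈ coneFaces x ∧ 0 < l (x v)).card = n := ⟨_, rfl⟩
  induction n using Nat.strong_induction_on generalizing F l with
  | _ n ih =>
  set U := Finset.univ.filter fun v => insert v F ∈ coneFaces x ∧ 0 < l (x v) with hU
  have hUmem : ∀ v, v ∈ U ↔ insert v F ∈ coneFaces x ∧ 0 < l (x v) := fun v => by simp [hU]
  have hlink : ∀ G v, v ∈ G → G ∪ F ∈ coneFaces x → insert v F ∈ coneFaces x := by
    intro G v hv hG
    refine coneFaces_mono hs hG ?_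
    rw [Finset.insert_subset_iff]
    exact ⟨Finset.mem_union_left _ hv, Finset.subset_union_right⟩
  obtain ⟨v₀, hv₀⟩ := exists_pos_insert_mem_coneFaces hs hF hx hl hneg hpos
  obtain ⟨-, b, hb⟩ := id hF
  have hUF : ∀ v ∈ U, v ∉ F := fun v hv h => ((hUmem v).1 hv).2.ne' (hl v h)
  -- The hyperplanes `l = t • b` sweep about `F`, starting from `l = 0`; `v` is a first vertex of
  -- the half-link that they meet.
  obtain ⟨v, hv, hmin⟩ := U.exists_min_image (fun v => l (x v) / b (x v))
    ⟨v₀, (hUmem v₀).2 hv₀⟩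
  have hbv := pos_of_supporting hb (hUF v hv)
  have hlv := ((hUmem v).1 hv).2
  by_cases hUv : U = {v}
  · refine isAcyclic_of_subsingleton v ⟨?_, ?_⟩ ?_
    · rw [← Finset.insert_eq]; exact ((hUmem v).1 hv).1
    · intro u hu
      rwa [Finset.mem_singleton.1 hu]
    · rintro G ⟨hG, hGl⟩ u hu
      rw [← hUv]
      exact (hUmem u).2 ⟨hlink G u hu hG, hGl u hu⟩
  obtain ⟨v₁, hv₁U, hv₁⟩ : ∃ u ∈ U, u ≠ v := by
    by_contra! h
    exact hUv (Finset.eq_singleton_iff_unique_mem.2 ⟨hv, h⟩)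
  set t := l (x v) / b (x v) with ht
  have ht0 : 0 < t := div_pos hlv hbv
  obtain ⟨-, f, hf⟩ := id ((hUmem v).1 hv).1
  set l₀ := l - t • b with hl₀
  -- The functional `l₀` may vanish at several vertices of `U`. Tilting by `f`, which supports
  -- `insert v F`, separates `v` from the rest of `U`, and a small `ε` preserves the negative
  -- values.
  obtain ⟨ε, hε, hεn⟩ := exists_pos_forall_add_mul_pos (fun w => -l₀ (x w)) (fun w => -f (x w))
  set l₁ := l₀ + ε • f with hl₁
  have hl₁e : ∀ w, l₁ (x w) = l (x w) - t * b (x w) + ε * f (x w) := fun w => by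
    simp [hl₁, hl₀]
  have hl₁F : ∀ w ∈ insert v F, l₁ (x w) = 0 := by
    intro w hw
    rw [hl₁e, (hf w).2.2 hw]
    rcases Finset.mem_insert.1 hw with rfl | hw
    · rw [ht]; field_simp; ring
    · rw [hl w hw, (hb w).2.2 hw]; ring
  have hl₁neg : ∀ w, w ∉ F → l (x w) ≤ 0 → l₁ (x w) < 0 := by
    intro w hwF hw
    have h1 := mul_pos ht0 (pos_of_supporting hb hwF)
    have h2 := hεn w (by simp [hl₀]; linarith)
    rw [hl₁e]
    simp only [hl₀, LinearMap.sub_apply, LinearMap.smul_apply, smul_eq_mul] at h2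
    linarith
  have hl₁pos : ∀ w ∈ U, w ≠ v → 0 < l₁ (x w) := by
    intro w hw hwv
    have h1 := (le_div_iff₀ (pos_of_supporting hb (hUF w hw))).1 (hmin w hw)
    have h2 := mul_pos hε (pos_of_supporting hf (v := w) (by simp [hwv, hUF w hw]))
    rw [hl₁e]
    linarith
  obtain ⟨w₀, hw₀⟩ := hneg
  have hw₀F : w₀ ∉ F := fun h => hw₀.ne (hl w₀ h)
  have hsub : ∀ w, insert w F ∈ coneFaces x → 0 < l₁ (x w) → w ∈ U ∧ w ≠ v := by
    intro w hw hw1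
    have hwv : w ≠ v := by
      rintro rfl
      exact hw1.ne' (hl₁F w (by simp))
    refine ⟨(hUmem w).2 ⟨hw, ?_⟩, hwv⟩
    by_contra! h
    have hwF : w ∉ F := fun h' => hw1.ne' (hl₁F w (by simp [h']))
    exact hw1.not_gt (hl₁neg w hwF h)
  obtain ⟨δ, hδ, hδp⟩ := exists_pos_forall_add_mul_pos (fun w => l₁ (x w)) (fun w => -b (x w))
  set l₂ := l₁ - δ • b with hl₂
  have hl₂e : ∀ w, l₂ (x w) = l₁ (x w) - δ * b (x w) := fun w => by simp [hl₂]
  have hl₂pos : ∀ w, 0 < l₂ (x w) ↔ 0 < l₁ (x w) := by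
    intro w
    rw [hl₂e]
    constructor
    · intro h
      have := mul_nonneg hδ.le (hb w).1
      linarith
    · intro h
      have := hδp w h
      linarith
  have hEq : ∀ G, G ∪ F ∈ coneFaces x →
      ((∀ w ∈ G, 0 < l₁ (x w)) ↔ v ∉ G ∧ ∀ w ∈ G, 0 < l (x w)) := by
    intro G hG
    constructor
    · intro h
      have h1 := fun w hw => hsub w (hlink G w hw hG) (h w hw)
      exact ⟨fun hvG => (h1 v hvG).2 rfl, fun w hw => ((hUmem w).1 (h1 w hw).1).2⟩
    · rintro ⟨hvG, h⟩ w hw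
      exact hl₁pos w ((hUmem w).2 ⟨hlink G w hw hG, h w hw⟩) (by rintro rfl; exact hvG hw)
  have hcard : ∀ A : Finset V, (∀ w ∈ A, w ∈ U ∧ w ≠ v) → A.card < n := by
    intro A hA
    rw [← hn]
    refine Finset.card_lt_card (Finset.ssubset_iff_subset_ne.2 ⟨fun w hw => (hA w hw).1, ?_⟩)
    rintro rfl
    exact (hA v hv).2 rfl
  -- The link of `v` in the half-link is the half-link of `insert v F` for `l₁`, and the deletion of
  -- `v` is the half-link of `F` for `l₂`. Both have fewer vertices.
  refine IsAcyclic.of_link_del v ?_ ?_ ?_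
  · rintro G ⟨hG, hGl⟩
    exact ⟨coneFaces_mono hs hG (Finset.union_subset_union_left (Finset.subset_insert _ _)),
      fun w hw => hGl w (Finset.mem_insert_of_mem hw)⟩
  · have h := ih _ (hcard _ ?_) ((hUmem v).1 hv).1 hl₁F
      ⟨w₀, hl₁neg w₀ hw₀F hw₀.le⟩ ⟨v₁, hl₁pos v₁ hv₁U hv₁⟩ rfl
    · convert h using 1
      ext G
      simp only [posLink, Set.mem_ofPred_eq, Finset.insert_union, Finset.union_insert]
      constructor
      · rintro ⟨hvG, hG, hGl⟩
        refine ⟨hG, (hEq G (coneFaces_mono hs hG (Finset.subset_insert _ _))).2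
          ⟨hvG, fun w hw => hGl w (Finset.mem_insert_of_mem hw)⟩⟩
      · rintro ⟨hG, hGl⟩
        obtain ⟨h1, h2⟩ := (hEq G (coneFaces_mono hs hG (Finset.subset_insert _ _))).1 hGl
        refine ⟨h1, hG, fun w hw => ?_⟩
        rcases Finset.mem_insert.1 hw with rfl | hw
        · exact hlv
        · exact h2 w hw
    · intro w hw
      simp only [Finset.mem_filter, Finset.mem_univ, true_and] at hw
      exact hsub w (coneFaces_mono hs hw.1
        (Finset.insert_subset_insert _ (Finset.subset_insert _ _))) hw.2
  · have h := ih _ (hcard _ ?_) hF (l := l₂) (fun w hw => by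
        rw [hl₂e, hl₁F w (Finset.mem_insert_of_mem hw), (hb w).2.2 hw]; ring)
      ⟨w₀, by
        have := mul_nonneg hδ.le (hb w₀).1
        have := hl₁neg w₀ hw₀F hw₀.le
        rw [hl₂e]; linarith⟩ ⟨v₁, (hl₂pos v₁).2 (hl₁pos v₁ hv₁U hv₁)⟩ rfl
    · convert h using 1
      ext G
      simp only [posLink, Set.mem_ofPred_eq, hl₂pos]
      constructor
      · rintro ⟨hvG, hG, hGl⟩
        exact ⟨hG, (hEq G hG).2 ⟨hvG, hGl⟩⟩
      · rintro ⟨hG, hGl⟩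
        obtain ⟨h1, h2⟩ := (hEq G hG).1 hGl
        exact ⟨h1, hG, h2⟩
    · intro w hw
      simp only [Finset.mem_filter, Finset.mem_univ, true_and, hl₂pos] at hw
      exact hsub w hw.1 hw.2

/-- The fundamental mod 2 chain of the link of `N`, whose facets have `n` elements in total. -/
noncomputable def linkCycle (x : V → X) (n : ℕ) (N : Finset V) (G : Finset V) : ZMod 2 :=
  open Classical in
  if Disjoint N G ∧ (N ∪ G).card + 1 = n ∧ N ∪ G ∈ coneFaces x then 1 else 0

lemma linkCycle_ne_zero {n : ℕ} {N G : Finset V} : linkCycle x n N G ≠ 0 ↔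
    Disjoint N G ∧ (N ∪ G).card + 1 = n ∧ N ∪ G ∈ coneFaces x := by
  unfold linkCycle
  split_ifs with h
  · exact iff_of_true one_ne_zero h
  · exact iff_of_false (by simp) h

-- The boundary at `G` counts the facets through the ridge `N ∪ G`, if `G` has the right size and is
-- disjoint from `N`; otherwise no term survives.
include hs in
lemma bdry_linkCycle [FiniteDimensional ℝ X] (hx : Submodule.span ℝ (Set.range x) = ⊤)
    (N : Finset V) : bdry (linkCycle x (Module.finrank ℝ X) N) = 0 := by
  classical
  ext G
  simp only [bdry, linkCycle, Finset.union_insert, Pi.zero_apply, Finset.sum_boole]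
  by_cases hG : Disjoint N G ∧ (N ∪ G).card + 2 = Module.finrank ℝ X
  · rw [ZMod.natCast_eq_zero_iff_even]
    refine even_card_facets_of_ridge hs hx hG.2 _ fun v => ?_
    simp only [Finset.mem_filter, Finset.mem_compl, Finset.disjoint_insert_right, Finset.mem_union,
      not_or]
    constructor
    · rintro ⟨h1, ⟨h2, -⟩, -, h3⟩
      exact ⟨⟨h2, h1⟩, h3⟩
    · rintro ⟨⟨h2, h1⟩, h3⟩
      refine ⟨h1, ⟨h2, hG.1⟩, ?_, h3⟩
      rw [Finset.card_insert_of_notMem (by simp [h1, h2])]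
      exact hG.2
  · rw [Finset.filter_false_of_mem]
    · simp
    · rintro v hv ⟨h1, h2, -⟩
      rw [Finset.disjoint_insert_right] at h1
      rw [Finset.card_insert_of_notMem (by simp at hv; simp [h1.1, hv])] at h2
      exact hG ⟨h1.2, h2⟩

end Acyclic

/-! ### Crossing parity for a generic ray -/

section RayCrossing

variable {V W : Type*} [Fintype V] [AddCommGroup W] [Module ℝ W]

/-- The vector `r` is a nonnegative combination of the vectors `u g`, `g ∈ G`. -/
def InCone (u : V → W) (r : W) (G : Finset V) : Prop :=
  ∃ c : V → ℝ, (∀ g, 0 ≤ c g) ∧ ∑ g ∈ G, c g • u g = r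

/-- The open simplicial cone over independent vectors contains a point that lies in none of the
subspaces spanned by fewer vectors. -/
lemma exists_generic_pos_combination (u : V → W) (G : Finset V)
    (hG : LinearIndepOn ℝ u (G : Set V)) :
    ∃ (r : W) (c : V → ℝ), (∀ g ∈ G, 0 < c g) ∧ ∑ g ∈ G, c g • u g = r ∧
      ∀ S : Finset V, S.card < G.card → r ∉ Submodule.span ℝ (u '' (S : Set V)) := by
  classical
  let T : (G → ℝ) →ₗ[ℝ] W := Fintype.linearCombination ℝ (fun g : G => u g)
  have hT : LinearMap.range T = Submodule.span ℝ (u '' (G : Set V)) := by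
    rw [Fintype.range_linearCombination, Set.image_eq_range]
    rfl
  -- Spans of fewer vectors pull back to proper subspaces of the coefficient space, which are null,
  -- whereas the open orthant has positive measure.
  have hnull : ∀ S ∈ {S : Finset V | S.card < G.card},
      MeasureTheory.volume
        ((Submodule.comap T (Submodule.span ℝ (u '' (S : Set V))) : Submodule ℝ (G → ℝ)) :
          Set (G → ℝ)) = 0 := by
    intro S hS
    refine MeasureTheory.Measure.addHaar_submodule _ _ fun h => ?_
    rw [← LinearMap.range_le_iff_comap, hT] at h
    have : FiniteDimensional ℝ (Submodule.span ℝ (u '' (S : Set V))) :=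
      FiniteDimensional.span_of_finite ℝ (S.finite_toSet.image u)
    have h1 := Submodule.finrank_mono h
    rw [finrank_span_image_eq_card hG] at h1
    have h2 := finrank_span_finset_le_card (R := ℝ) (S.image u)
    rw [Finset.coe_image] at h2
    have h3 := Finset.card_image_le (s := S) (f := u)
    have h4 : S.card < G.card := hS
    have h5 : Module.finrank ℝ (Submodule.span ℝ (u '' (S : Set V))) ≤ (S.image u).card := h2
    omega
  have hopen : IsOpen {c : G → ℝ | ∀ g, 0 < c g} := by
    simp only [Set.ofPred_forall]
    exact isOpen_iInter_of_finite fun g => isOpen_lt continuous_const (continuous_apply g)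
  have hposm := hopen.measure_pos MeasureTheory.volume ⟨fun _ => 1, fun _ => one_pos⟩
  have hU := (MeasureTheory.measure_biUnion_null_iff
    (Set.to_countable {S : Finset V | S.card < G.card})).2 hnull
  obtain ⟨c, hc, hcU⟩ := MeasureTheory.nonempty_of_measure_ne_zero
    (μ := MeasureTheory.volume) (by
      rw [MeasureTheory.measure_sdiff_null hU]
      exact hposm.ne')
  refine ⟨T c, fun g => if h : g ∈ G then c ⟨g, h⟩ else 0, fun g hg => by simpa [hg] using hc ⟨g, hg⟩,
    ?_, fun S hS h => hcU (Set.mem_biUnion hS h)⟩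
  rw [← Finset.sum_coe_sort, Fintype.linearCombination_apply]
  exact Finset.sum_congr rfl fun g _ => by simp

variable [DecidableEq V]

/-- A generic ray crosses the boundary of a simplex that misses the origin an even number of
times. -/
lemma even_card_inCone_erase [FiniteDimensional ℝ W] (u : V → W) (r : W)
    (hr : ∀ S : Finset V, S.card < Module.finrank ℝ W → r ∉ Submodule.span ℝ (u '' (S : Set V)))
    (H : Finset V) (hH : H.card = Module.finrank ℝ W + 1)
    (hH0 : ∀ c : V → ℝ, (∀ v ∈ H, 0 ≤ c v) → ∑ v ∈ H, c v • u v = 0 → ∀ v ∈ H, c v = 0)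
    (A : Finset V) (hA : ∀ v, v ∈ A ↔ v ∈ H ∧ InCone u r (H.erase v)) : Even A.card := by
  classical
  -- The kernel consists of the relations expressing a multiple of `r` through the vectors of `H`.
  -- By `hH0` this multiple is positive for a nonzero nonnegative relation, so a zero at `v` puts
  -- `r` in the cone over `H.erase v`.
  let L : (Option H → ℝ) →ₗ[ℝ] W :=
    Fintype.linearCombination ℝ (fun o : Option H => o.elim (-r) fun v => u v)
  have hL : ∀ f, L f = ∑ v : H, f (some v) • u v - f none • r := by
    intro f
    simp only [L, Fintype.linearCombination_apply, Fintype.sum_option, Option.elim, smul_neg]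
    abel
  have hdim : 2 ≤ Module.finrank ℝ (LinearMap.ker L) := by
    have h1 := LinearMap.finrank_range_add_finrank_ker L
    have h2 := Submodule.finrank_le (LinearMap.range L)
    simp at h1
    omega
  let ex : (Option H → ℝ) → V → ℝ := fun f v => if h : v ∈ H then f (some ⟨v, h⟩) else 0
  have hex : ∀ f (v : H), ex f v = f (some v) := fun f v => by simp [ex]
  have hexs : ∀ f, L f = 0 → ∑ v ∈ H, ex f v • u v = f none • r := by
    intro f hf
    rw [hL, sub_eq_zero] at hf
    rw [← hf, ← Finset.sum_coe_sort]
    exact Finset.sum_congr rfl fun v _ => by rw [hex]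
  have hnone : ∀ f ∈ LinearMap.ker L, f ≠ 0 → 0 ≤ f → 0 < f none := by
    intro f hf hf0 hfn
    refine (hfn none).lt_of_ne fun h => hf0 ?_
    have h1 := hexs f hf
    rw [← h] at h1
    simp only [Pi.zero_apply, zero_smul] at h1
    have h2 := hH0 (ex f) (fun v hv => by simpa [ex, hv] using hfn _) h1
    ext o
    cases o with
    | none => exact h.symm
    | some v => rw [← hex f v, h2 v v.2]; rfl
  have hcard : A.card = (Finset.univ.filter fun o : Option H => ∃ v : H, o = some v ∧ v.1 ∈ A).card := by
    refine Finset.card_bij (fun v hv => some ⟨v, ((hA v).1 hv).1⟩) ?_ ?_ ?_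
    · intro v hv
      simp [hv, ((hA v).1 hv).1]
    · intro v _ w _ h
      simpa using h
    · intro o ho
      simp only [Finset.mem_filter, Finset.mem_univ, true_and] at ho
      obtain ⟨v, rfl, hv⟩ := ho
      exact ⟨v, hv, rfl⟩
  rw [hcard]
  refine even_card_zeros_of_two_le_finrank (LinearMap.ker L) hdim ?_ _ ?_
  -- Two vanishing coefficients would leave `r` in the span of only `finrank W - 1` vectors, against
  -- genericity.
  · intro f hf hf0 hfn i j hi hj
    have h0 := hnone f hf hf0 hfn
    cases i with
    | none => exact absurd hi h0.ne'
    | some i =>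
      cases j with
      | none => exact absurd hj h0.ne'
      | some j =>
        by_contra hij
        have hij' : j.1 ≠ i.1 := fun h => hij (by rw [Subtype.ext h])
        refine hr ((H.erase i).erase j) ?_ ?_
        · have h2 : j.1 ∈ H.erase i.1 := by simp [hij']
          have := Finset.card_erase_lt_of_mem h2
          have := Finset.card_erase_of_mem i.2
          omega
        · have h1 := hexs f hf
          rw [← Finset.add_sum_erase _ _ i.2, hex, hi, zero_smul, zero_add,
            ← Finset.add_sum_erase _ _ (show j.1 ∈ H.erase i.1 by simp [hij']), hex, hj, zero_smul,
            zero_add] at h1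
          have h2 : r = (f none)⁻¹ • ∑ v ∈ (H.erase i).erase j, ex f v • u v := by
            rw [h1, smul_smul, inv_mul_cancel₀ h0.ne', one_smul]
          rw [h2]
          exact Submodule.smul_mem _ _ (Submodule.sum_mem _ fun v hv =>
            Submodule.smul_mem _ _ (Submodule.subset_span ⟨v, hv, rfl⟩))
  · intro o
    simp only [Finset.mem_filter, Finset.mem_univ, true_and]
    constructor
    · rintro ⟨v, rfl, hv⟩
      obtain ⟨-, c, hc, hcr⟩ := (hA v).1 hv
      refine ⟨fun o => o.elim 1 fun w => if w = v then 0 else c w, ?_, ?_, ?_, by simp⟩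
      · rw [LinearMap.mem_ker, hL, sub_eq_zero]
        simp only [Option.elim, one_smul, ← hcr]
        have h1 : ∑ w : H, (if w = v then 0 else c w) • u w =
            ∑ w : H, (if w.1 = v.1 then 0 else c w) • u w := by simp only [Subtype.ext_iff]
        rw [h1, Finset.sum_coe_sort H (fun w => (if w = v.1 then 0 else c w) • u w),
          ← Finset.add_sum_erase _ _ v.2]
        simp only [if_true, zero_smul, zero_add]
        exact Finset.sum_congr rfl fun w hw => by simp [Finset.ne_of_mem_erase hw]
      · intro h
        simpa using congrFun h none
      · intro o
        cases o with
        | none => simp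
        | some w =>
          by_cases h : w = v <;> simp [h, hc]
    · rintro ⟨f, hf, hf0, hfn, hfo⟩
      have h0 := hnone f hf hf0 hfn
      cases o with
      | none => exact absurd hfo h0.ne'
      | some v =>
        refine ⟨v, rfl, (hA v).2 ⟨v.2, fun w => (f none)⁻¹ * ex f w, fun w => ?_, ?_⟩⟩
        · refine mul_nonneg (inv_nonneg.2 h0.le) ?_
          by_cases hw : w ∈ H
          · simpa [ex, hw] using hfn _
          · simp [ex, hw]
        · have h1 := hexs f hf
          rw [← Finset.add_sum_erase _ _ v.2, hex, hfo, zero_smul, zero_add] at h1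
          simp only [mul_smul]
          rw [← Finset.smul_sum, h1, smul_smul, inv_mul_cancel₀ h0.ne', one_smul]

end RayCrossing

/-! ### Comparing the face complexes of two simplicial cones -/

section Comparison

variable {V X Y : Type*} [Fintype V] [AddCommGroup X] [Module ℝ X]
  {x : V → X} [AddCommGroup Y] [Module ℝ Y] [FiniteDimensional ℝ Y]
  {y : V → Y}

/-- The cone over a face disjoint from a missing face `M` meets the span of `M` only in the
origin. -/
lemma eq_zero_of_sum_mem_span_missing {M H : Finset V} (hM : IsMissingFace (coneFaces x) M)
    (hMne : M.Nonempty) (hH : H ∈ coneFaces x) (hHM : Disjoint H M) (c : V → ℝ)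
    (hc : ∀ v ∈ H, 0 ≤ c v)
    (hsum : ∑ v ∈ H, c v • x v ∈ Submodule.span ℝ (x '' (M : Set V))) : ∀ v ∈ H, c v = 0 := by
  classical
  rw [Submodule.mem_span_image_finset_iff_exists_fun'] at hsum
  obtain ⟨a, ha⟩ := hsum
  have hval : ∀ f : Module.Dual ℝ X, ∑ m ∈ M, a m * f (x m) = ∑ v ∈ H, c v * f (x v) := by
    intro f
    simpa using congrArg f ha
  obtain ⟨-, f, hf⟩ := hH
  -- If all `a m` are positive, a functional supporting `H` separates the two sides. Otherwise the
  -- labels with positive `a m` form a proper subset of `M`, hence a face, and a functional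
  -- supporting it forces `c` to vanish.
  by_cases hall : ∀ m ∈ M, 0 < a m
  · have h1 := hval f
    rw [Finset.sum_eq_zero (s := H) fun v hv => by rw [(hf v).2.2 hv, mul_zero]] at h1
    have h2 : 0 < ∑ m ∈ M, a m * f (x m) := Finset.sum_pos (fun m hm =>
      mul_pos (hall m hm) (pos_of_supporting hf fun h => Finset.disjoint_left.1 hHM h hm)) hMne
    exact absurd h1 h2.ne'
  · have hlt : M.filter (fun m => 0 < a m) ⊂ M := by
      rw [Finset.filter_ssubset]
      push Not at hall ⊢
      exact hall
    obtain ⟨-, g, hg⟩ := hM.2 _ hlt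
    have h1 := hval g
    have h2 : ∑ m ∈ M, a m * g (x m) ≤ 0 := by
      refine Finset.sum_nonpos fun m hm => ?_
      by_cases hm' : 0 < a m
      · rw [(hg m).2.2 (by simp [hm, hm']), mul_zero]
      · exact mul_nonpos_of_nonpos_of_nonneg (not_lt.1 hm') (hg m).1
    have h3 : ∀ v ∈ H, 0 ≤ c v * g (x v) := fun v hv => mul_nonneg (hc v hv) (hg v).1
    intro v hv
    have h4 := (Finset.sum_eq_zero_iff_of_nonneg h3).1
      (le_antisymm (h1 ▸ h2) (Finset.sum_nonneg h3)) v hv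
    have h5 : 0 < g (x v) := pos_of_supporting hg fun h =>
      Finset.disjoint_left.1 hHM hv (Finset.mem_filter.1 h).1
    exact (mul_eq_zero.1 h4).resolve_right h5.ne'

variable [DecidableEq V] (hsx : ∀ W ∈ coneFaces x, LinearIndepOn ℝ x (W : Set V))
  (hsy : ∀ W ∈ coneFaces y, LinearIndepOn ℝ y (W : Set V))

include hsx in
/-- A facet of the link of a codimension one face of a missing face is determined by a point in
the relative interiors of two projected cones. -/
lemma facet_eq_of_inCone {M N : Finset V} {w : V} (hN : N = M.erase w) (hw : w ∈ M)
    (hM : M ∉ coneFaces x) {G₀ G : Finset V}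
    (hG₀ : N ∪ G₀ ∈ coneFaces x) (hG : N ∪ G ∈ coneFaces x)
    (hGd : Disjoint N G) (hG₀d : Disjoint N G₀) {c₀ c : V → ℝ} (hc₀ : ∀ g ∈ G₀, 0 < c₀ g)
    (hc : ∀ g ∈ G, 0 < c g)
    (hsum : ∑ g ∈ G₀, c₀ g • x g - ∑ g ∈ G, c g • x g ∈ Submodule.span ℝ (x '' (M : Set V))) :
    G₀ ⊆ G ∨ G ⊆ G₀ := by
  have hMi : M = insert w N := by rw [hN, Finset.insert_erase hw]
  have hwN : w ∉ N := by simp [hN]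
  have hwG : ∀ K, N ∪ K ∈ coneFaces x → w ∉ N ∪ K := by
    intro K hK hwK
    refine hM (coneFaces_mono hsx hK ?_)
    rw [hMi, Finset.insert_subset_iff]
    exact ⟨hwK, Finset.subset_union_left⟩
  rw [Submodule.mem_span_image_finset_iff_exists_fun'] at hsum
  obtain ⟨a, ha⟩ := hsum
  have hwG₁ := hwG G hG
  have hwG₀ := hwG G₀ hG₀
  obtain ⟨-, f, hf⟩ := hG
  obtain ⟨-, f₀, hf₀⟩ := hG₀
  have hval : ∀ f : Module.Dual ℝ X, (∀ v ∈ N, f (x v) = 0) →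
      a w * f (x w) = ∑ v ∈ G₀, c₀ v * f (x v) - ∑ v ∈ G, c v * f (x v) := by
    intro f hf
    have h1 := congrArg f ha
    rw [hMi, Finset.sum_insert hwN] at h1
    simp only [map_add, map_sum, map_sub, map_smul, smul_eq_mul] at h1
    rwa [Finset.sum_eq_zero (s := N) fun v hv => by rw [hf v hv, mul_zero], add_zero] at h1
  -- Modulo `N` only the multiple of `x w` remains, and its sign decides which facet's supporting
  -- functional to apply.
  rcases le_total (a w) 0 with haw | haw
  · left
    have h1 := hval f fun v hv => (hf v).2.2 (Finset.mem_union_left _ hv)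
    rw [Finset.sum_eq_zero (s := G) fun v hv => by
      rw [(hf v).2.2 (Finset.mem_union_right _ hv), mul_zero], sub_zero] at h1
    have h3 : ∀ v ∈ G₀, 0 ≤ c₀ v * f (x v) := fun v hv => mul_nonneg (hc₀ v hv).le (hf v).1
    have h2 : a w * f (x w) ≤ 0 := mul_nonpos_of_nonpos_of_nonneg haw (hf w).1
    intro v hv
    have h4 := (Finset.sum_eq_zero_iff_of_nonneg h3).1
      (le_antisymm (h1 ▸ h2) (Finset.sum_nonneg h3)) v hv
    have h5 := (hf v).2.1 ((mul_eq_zero.1 h4).resolve_left (hc₀ v hv).ne')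
    exact (Finset.mem_union.1 h5).resolve_left fun h => Finset.disjoint_left.1 hG₀d h hv
  · right
    have h1 := hval f₀ fun v hv => (hf₀ v).2.2 (Finset.mem_union_left _ hv)
    rw [Finset.sum_eq_zero (s := G₀) fun v hv => by
      rw [(hf₀ v).2.2 (Finset.mem_union_right _ hv), mul_zero], zero_sub] at h1
    have h3 : ∀ v ∈ G, 0 ≤ c v * f₀ (x v) := fun v hv => mul_nonneg (hc v hv).le (hf₀ v).1
    have h2 : 0 ≤ a w * f₀ (x w) := mul_nonneg haw (hf₀ w).1
    intro v hv
    have h4 := (Finset.sum_eq_zero_iff_of_nonneg h3).1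
      (le_antisymm (by linarith) (Finset.sum_nonneg h3)) v hv
    have h5 := (hf₀ v).2.1 ((mul_eq_zero.1 h4).resolve_left (hc v hv).ne')
    exact (Finset.mem_union.1 h5).resolve_left fun h => Finset.disjoint_left.1 hGd h hv

variable [FiniteDimensional ℝ X]

include hsx hsy in
/-- If two simplicial cones of the same dimension have the same faces with at most `k` elements,
then a missing face of the first of codimension less than `k` is not a face of the second. -/
theorem notMem_coneFaces_of_missing_of_large (hx : Submodule.span ℝ (Set.range x) = ⊤)
    (hy : Submodule.span ℝ (Set.range y) = ⊤)
    (hXY : Module.finrank ℝ X = Module.finrank ℝ Y) {k : ℕ}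
    (hsk : ∀ W : Finset V, W.card ≤ k → (W ∈ coneFaces x ↔ W ∈ coneFaces y))
    {M : Finset V} (hM : IsMissingFace (coneFaces x) M)
    (hMk : Module.finrank ℝ X + 1 ≤ M.card + k) : M ∉ coneFaces y := by
  classical
  intro hMy
  have hMcard := card_add_one_le_of_mem_coneFaces hsy hMy
  rw [← hXY] at hMcard
  have hMne : M.Nonempty := by
    by_contra h
    rw [Finset.not_nonempty_iff_eq_empty] at h
    subst h
    exact hM.1 ((hsk ∅ (by simp)).2 hMy)
  obtain ⟨w, hw⟩ := id hMne
  obtain ⟨N, hN⟩ : ∃ N, N = M.erase w := ⟨_, rfl⟩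
  have hNx : N ∈ coneFaces x := hM.2 N (hN ▸ Finset.erase_ssubset hw)
  have hNc : N.card + 1 = M.card := by rw [hN]; exact Finset.card_erase_add_one hw
  have hMi : M = insert w N := by rw [hN, Finset.insert_erase hw]
  obtain ⟨B, hB, hNB, hBc⟩ := exists_facet_superset hsx hx hNx
  have hwB : w ∉ B := fun h => hM.1 (coneFaces_mono hsx hB (by
    rw [hMi, Finset.insert_subset_iff]; exact ⟨h, hNB⟩))
  obtain ⟨G₀, hG₀⟩ : ∃ G, G = B \ N := ⟨_, rfl⟩
  have hNG₀ : N ∪ G₀ = B := by rw [hG₀, Finset.union_sdiff_of_subset hNB]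
  have hG₀d : Disjoint N G₀ := by rw [hG₀]; exact Finset.disjoint_sdiff
  have hG₀c : N.card + G₀.card = B.card := by
    rw [← Finset.card_union_of_disjoint hG₀d, hNG₀]
  have hwBli : LinearIndepOn ℝ x (insert w (B : Set V)) := by
    refine (hsx B hB).insert fun h => ?_
    obtain ⟨-, f, hf⟩ := hB
    have h1 : Submodule.span ℝ (x '' (B : Set V)) ≤ LinearMap.ker f := by
      rw [Submodule.span_le]
      rintro _ ⟨u, hu, rfl⟩
      exact (hf u).2.2 hu
    exact hwB ((hf w).2.1 (h1 h))
  have hMG₀ : Disjoint M G₀ := by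
    rw [hMi, Finset.disjoint_insert_left]
    exact ⟨fun h => hwB (hNG₀ ▸ Finset.mem_union_right _ h), hG₀d⟩
  have hMGli : LinearIndepOn ℝ x ((M : Set V) ∪ G₀) := by
    convert hwBli using 1
    rw [hMi, ← hNG₀]
    push_cast
    rw [Set.insert_union]
  obtain ⟨hMli, hG₀li, hdisj⟩ :=
    (linearIndepOn_union_iff (Finset.disjoint_coe.2 hMG₀)).1 hMGli
  set S := Submodule.span ℝ (x '' (M : Set V)) with hS
  let u : V → X ⧸ S := fun v => S.mkQ (x v)
  have hfr : Module.finrank ℝ (X ⧸ S) + M.card = Module.finrank ℝ X := by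
    rw [← finrank_span_image_eq_card hMli]
    exact Submodule.finrank_quotient_add_finrank S
  have hG₀e : G₀.card = Module.finrank ℝ (X ⧸ S) := by omega
  have hu : LinearIndepOn ℝ u (G₀ : Set V) := by
    refine LinearIndependent.map hG₀li ?_
    rw [Submodule.ker_mkQ, ← Set.image_eq_range]
    exact hdisj.symm
  obtain ⟨r, c₀, hc₀, hc₀r, hr⟩ := exists_generic_pos_combination u G₀ hu
  rw [hG₀e] at hr
  have husum : ∀ (G : Finset V) (c : V → ℝ),
      ∑ g ∈ G, c g • u g = S.mkQ (∑ g ∈ G, c g • x g) := fun G c => by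
    simp [u]
  -- The crossing cochain of the ray through `r`, restricted to the dimension of `z`.
  let φ : Finset V → ZMod 2 := fun G => if G.card = G₀.card ∧ InCone u r G then 1 else 0
  let z := linkCycle x (Module.finrank ℝ X) N
  have hzG : ∀ G, z G ≠ 0 → G.card = G₀.card ∧ G ∈ coneFaces x ∧ Disjoint M G := by
    intro G hG
    obtain ⟨h1, h2, h3⟩ := linkCycle_ne_zero.1 hG
    rw [Finset.card_union_of_disjoint h1] at h2
    refine ⟨by omega, coneFaces_mono hsx h3 Finset.subset_union_right, ?_⟩
    rw [hMi, Finset.disjoint_insert_left]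
    refine ⟨fun h => hM.1 (coneFaces_mono hsx h3 ?_), h1⟩
    rw [hMi, Finset.insert_subset_iff]
    exact ⟨Finset.mem_union_right _ h, Finset.subset_union_left⟩
  have hone : ∑ G, φ G * z G = 1 := by
    rw [Finset.sum_eq_single G₀]
    · have h1 : φ G₀ = 1 := by
        refine if_pos ⟨rfl, fun g => if g ∈ G₀ then c₀ g else 0, fun g => ?_, ?_⟩
        · by_cases h : g ∈ G₀
          · simpa [h] using (hc₀ g h).le
          · simp [h]
        · rw [← hc₀r]
          exact Finset.sum_congr rfl fun g hg => by simp [hg]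
      have h2 : z G₀ = 1 := if_pos ⟨hG₀d, by rw [hNG₀]; exact hBc, by rw [hNG₀]; exact hB⟩
      rw [h1, h2, one_mul]
    · intro G _ hGne
      by_contra hne
      have hzne : z G ≠ 0 := right_ne_zero_of_mul hne
      obtain ⟨hGc, -, -⟩ := hzG G hzne
      obtain ⟨h1, h2, h3⟩ := linkCycle_ne_zero.1 hzne
      have hφ : InCone u r G := by
        by_contra h
        exact left_ne_zero_of_mul hne (if_neg fun h' => h h'.2)
      obtain ⟨c, hc, hcr⟩ := hφ
      have hcpos : ∀ g ∈ G, 0 < c g := by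
        intro g hg
        refine (hc g).lt_of_ne fun h0 => hr (G.erase g) ?_ ?_
        · rw [← hG₀e, ← hGc]
          exact Finset.card_erase_lt_of_mem hg
        · rw [← hcr, ← Finset.add_sum_erase _ _ hg, ← h0, zero_smul, zero_add]
          exact Submodule.sum_mem _ fun v hv =>
            Submodule.smul_mem _ _ (Submodule.subset_span ⟨v, hv, rfl⟩)
      have hmem : ∑ g ∈ G₀, c₀ g • x g - ∑ g ∈ G, c g • x g ∈ S := by
        rw [← Submodule.ker_mkQ S, LinearMap.mem_ker, map_sub, ← husum, ← husum, hc₀r, hcr,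
          sub_self]
      rcases facet_eq_of_inCone hsx hN hw hM.1 (hNG₀ ▸ hB) h3 h1 hG₀d hc₀ hcpos hmem with h | h
      · exact hGne (Finset.eq_of_subset_of_card_le h hGc.le).symm
      · exact hGne (Finset.eq_of_subset_of_card_le h hGc.ge)
    · simp
  obtain ⟨hMu, f, hf⟩ := id hMy
  obtain ⟨-, p, hp⟩ := coneFaces_mono hsy hMy (Finset.empty_subset M)
  have hp0 : ∀ v, 0 < p (y v) := fun v => pos_of_supporting hp (by simp)
  -- As `p` is positive on every generator, `f - δ • p` is negative exactly on `M`. The half-link of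
  -- `∅` is then the complex of faces avoiding `M`.
  obtain ⟨δ, hδ, hδp⟩ := exists_pos_forall_add_mul_pos (fun v => f (y v)) (fun v => -p (y v))
  have hlpos : ∀ v, v ∉ M → 0 < (f - δ • p) (y v) := by
    intro v hv
    have := hδp v (pos_of_supporting hf hv)
    simp only [LinearMap.sub_apply, LinearMap.smul_apply, smul_eq_mul]
    linarith
  have hlneg : ∀ v ∈ M, (f - δ • p) (y v) < 0 := by
    intro v hv
    have := mul_pos hδ (hp0 v)
    simp only [LinearMap.sub_apply, LinearMap.smul_apply, smul_eq_mul, (hf v).2.2 hv]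
    linarith
  obtain ⟨v₁, hv₁⟩ : ∃ v, v ∉ M := by
    by_contra! h
    exact hMu (Finset.eq_univ_iff_forall.2 h)
  obtain ⟨c, hc, hcz⟩ := isAcyclic_posLink hsy hy
    (coneFaces_mono hsy hMy (Finset.empty_subset M)) (l := f - δ • p) (by simp)
    ⟨w, hlneg w hw⟩ ⟨v₁, hlpos v₁ hv₁⟩ z (by
      intro G hG
      obtain ⟨h1, h2, h3⟩ := hzG G hG
      refine ⟨?_, fun v hv => hlpos v (Finset.disjoint_right.1 h3 hv)⟩
      rw [Finset.union_empty]
      exact (hsk G (by omega)).1 h2) (bdry_linkCycle hsx hx N)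
  -- Summation by parts rewrites the crossing number of `z` as a sum, over the simplices of its
  -- filling, of the crossing numbers of their boundaries.
  rw [← hcz, sum_mul_bdry, Finset.sum_eq_zero] at hone
  · exact zero_ne_one hone
  · intro H _
    by_cases hcH : c H = 0
    · rw [hcH, zero_mul]
    obtain ⟨hHy, hHl⟩ := hc H hcH
    rw [Finset.union_empty] at hHy
    have hHM : Disjoint H M := Finset.disjoint_left.2 fun v hv hvM =>
      (hHl v hv).not_gt (hlneg v hvM)
    have hHe : ∀ v ∈ H, (H.erase v).card + 1 = H.card := fun v hv =>
      Finset.card_erase_add_one hv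
    by_cases hHc : H.card = G₀.card + 1
    · have hHx : H ∈ coneFaces x := (hsk H (by omega)).2 hHy
      have heven := even_card_inCone_erase u r hr H (by omega) (fun c hc h => by
        rw [husum, ← LinearMap.mem_ker, Submodule.ker_mkQ] at h
        exact eq_zero_of_sum_mem_span_missing hM hMne hHx hHM c hc h)
        (H.filter fun v => InCone u r (H.erase v)) (by simp)
      have h1 : ∑ v ∈ H, φ (H.erase v) = ∑ v ∈ H, if InCone u r (H.erase v) then 1 else 0 := by
        refine Finset.sum_congr rfl fun v hv => ?_
        have := hHe v hv
        have h2 : (H.erase v).card = G₀.card := by omega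
        simp [φ, h2]
      rw [h1, Finset.sum_boole, (ZMod.natCast_eq_zero_iff_even).2 heven, mul_zero]
    · rw [Finset.sum_eq_zero, mul_zero]
      intro v hv
      have := hHe v hv
      exact if_neg fun h => hHc (by omega)

include hsx hsy in
/-- A simplicial sphere that contains another one of the same dimension is equal to it. -/
theorem coneFaces_eq_of_subset (hx : Submodule.span ℝ (Set.range x) = ⊤)
    (hy : Submodule.span ℝ (Set.range y) = ⊤)
    (hXY : Module.finrank ℝ X = Module.finrank ℝ Y) (h0 : ∅ ∈ coneFaces y)
    (hsub : coneFaces y ⊆ coneFaces x) : coneFaces y = coneFaces x := by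
  classical
  refine hsub.antisymm fun W hW => ?_
  by_contra hWy
  obtain ⟨B, hB, hWB, hBc⟩ := exists_facet_superset hsx hx hW
  have hBy : B ∉ coneFaces y := fun h => hWy (coneFaces_mono hsy h hWB)
  obtain ⟨R, ⟨hRB, hRy⟩, hmax⟩ := (Set.toFinite {R | R ⊆ B ∧ R ∈ coneFaces y}).exists_maximalFor
    Finset.card _ ⟨∅, Finset.empty_subset B, h0⟩
  have hmax' : ∀ v ∈ B, v ∉ R → insert v R ∉ coneFaces y := by
    intro v hv hvR h
    have h1 := hmax ⟨Finset.insert_subset hv hRB, h⟩ (Finset.card_le_card (Finset.subset_insert v R))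
    rw [Finset.card_insert_of_notMem hvR] at h1
    omega
  have hRx := hsub hRy
  obtain ⟨v₀, hv₀B, hv₀R⟩ : ∃ v ∈ B, v ∉ R := by
    by_contra! h
    exact hBy (hRB.antisymm h ▸ hRy)
  obtain ⟨C, hC, hRC, hCc⟩ := exists_facet_superset hsy hy hRy
  obtain ⟨hBu, f, hf⟩ := id hB
  obtain ⟨-, b, hb⟩ := id hRx
  -- The functional `f - δ • b` vanishes on `R`, is negative on `B \ R` and positive off `B`. By
  -- maximality of `R`, its link in the smaller complex avoids `B` and so lies in the positive
  -- half-link.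
  obtain ⟨δ, hδ, hδp⟩ := exists_pos_forall_add_mul_pos (fun v => f (x v)) (fun v => -b (x v))
  have hlpos : ∀ v, v ∉ B → 0 < (f - δ • b) (x v) := by
    intro v hv
    have := hδp v (pos_of_supporting hf hv)
    simp only [LinearMap.sub_apply, LinearMap.smul_apply, smul_eq_mul]
    linarith
  have hlneg : (f - δ • b) (x v₀) < 0 := by
    have := mul_pos hδ (pos_of_supporting hb hv₀R)
    simp only [LinearMap.sub_apply, LinearMap.smul_apply, smul_eq_mul, (hf v₀).2.2 hv₀B]
    linarith
  obtain ⟨v₁, hv₁⟩ : ∃ v, v ∉ B := by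
    by_contra! h
    exact hBu (Finset.eq_univ_iff_forall.2 h)
  obtain ⟨c, hc, hcz⟩ := isAcyclic_posLink hsx hx hRx (l := f - δ • b)
    (fun v hv => by simp [(hf v).2.2 (hRB hv), (hb v).2.2 hv]) ⟨v₀, hlneg⟩ ⟨v₁, hlpos v₁ hv₁⟩
    (linkCycle y (Module.finrank ℝ Y) R) (by
      intro G hG
      obtain ⟨h1, h2, h3⟩ := linkCycle_ne_zero.1 hG
      refine ⟨Finset.union_comm R G ▸ hsub h3, fun v hv => hlpos v fun hvB => ?_⟩
      refine hmax' v hvB (Finset.disjoint_right.1 h1 hv) (coneFaces_mono hsy h3 ?_)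
      rw [Finset.insert_subset_iff]
      exact ⟨Finset.mem_union_right _ hv, Finset.subset_union_left⟩) (bdry_linkCycle hsy hy R)
  have hRCu : R ∪ C \ R = C := Finset.union_sdiff_of_subset hRC
  have hne : linkCycle y (Module.finrank ℝ Y) R (C \ R) ≠ 0 := by
    rw [linkCycle_ne_zero, hRCu]
    exact ⟨Finset.disjoint_sdiff, hCc, hC⟩
  rw [← hcz] at hne
  -- The link cycle is nonzero at `C \ R`, so its filling contains a simplex one vertex larger;
  -- together with `R` this exceeds the size of a facet.
  obtain ⟨v, hv, hcv⟩ := Finset.exists_ne_zero_of_sum_ne_zero hne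
  have h1 := card_add_one_le_of_mem_coneFaces hsx (hc _ hcv).1
  have h2 : insert v (C \ R) ∪ R = insert v C := by
    rw [Finset.insert_union, Finset.sdiff_union_of_subset hRC]
  have hvC : v ∉ C := by
    intro h
    by_cases hvR : v ∈ R
    · have h3 := (hc _ hcv).2 v (by simp)
      simp [(hf v).2.2 (hRB hvR), (hb v).2.2 hvR] at h3
    · simp [h, hvR] at hv
  rw [h2, Finset.card_insert_of_notMem hvC] at h1
  omega

end Comparison

/-! ### From polytopes to cones -/

namespace SimplicialPolytope

variable {d : ℕ} {V : Type*} [Fintype V]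

/-- The homogenized position vector `(p v, 1)`. -/
def homog (P : SimplicialPolytope d V) (v : V) : EuclideanSpace ℝ (Fin d) × ℝ := (P.pos v, 1)

lemma finrank_homogSpace (d : ℕ) :
    Module.finrank ℝ (EuclideanSpace ℝ (Fin d) × ℝ) = d + 1 := by simp

lemma span_range_homog (P : SimplicialPolytope d V) :
    Submodule.span ℝ (Set.range P.homog) = ⊤ := by
  set S := Submodule.span ℝ (Set.range P.homog) with hS
  have h1 : ∀ e : EuclideanSpace ℝ (Fin d), (e, (1 : ℝ)) ∈ S := by
    intro e
    have he : e ∈ affineSpan ℝ (Set.range P.pos) := by rw [P.full_dim]; trivial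
    refine affineSpan_induction (p := fun e => (e, (1 : ℝ)) ∈ S) he ?_ ?_
    · rintro _ ⟨v, rfl⟩
      exact Submodule.subset_span ⟨v, rfl⟩
    · intro c u v w hu hv hw
      have := S.add_mem (S.smul_mem c (S.sub_mem hu hv)) hw
      simpa using this
  rw [eq_top_iff]
  rintro ⟨e, s⟩ -
  have := S.add_mem (S.sub_mem (h1 e) (h1 0)) (S.smul_mem s (h1 0))
  simpa using this

lemma nonempty_labels (P : SimplicialPolytope d V) : Nonempty V := by
  by_contra h
  rw [not_nonempty_iff] at h
  have h1 := P.full_dim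
  rw [Set.range_eq_empty, AffineSubspace.span_empty] at h1
  exact AffineSubspace.bot_ne_top ℝ _ _ h1

/-- The half-space `⟪b, e⟫ ≥ α` corresponds to the functional `(e, s) ↦ ⟪b, e⟫ - α s`. The last
coordinate is positive on all generators and accounts for `∅`; `b ≠ 0` matches `W ≠ univ`. -/
lemma boundary_eq_coneFaces (P : SimplicialPolytope d V) : P.boundary = coneFaces P.homog := by
  have hne := P.nonempty_labels
  ext W
  constructor
  · rintro (rfl | ⟨F, ⟨b, α, hb, hPb, hF, -⟩, hW⟩)
    · refine ⟨?_, LinearMap.snd ℝ _ _, fun v => by simp [homog]⟩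
      exact (Finset.univ_nonempty (α := V)).ne_empty.symm
    · let f : Module.Dual ℝ (EuclideanSpace ℝ (Fin d) × ℝ) :=
        (innerₛₗ ℝ b).comp (LinearMap.fst ℝ _ _) - α • LinearMap.snd ℝ _ _
      have hf : ∀ e s, f (e, s) = inner ℝ b e - α * s := fun e s => by simp [f]
      have hmem : ∀ v, P.pos v ∈ convexHull ℝ (Set.range P.pos) :=
        fun v => subset_convexHull ℝ _ ⟨v, rfl⟩
      have hfW : ∀ v, 0 ≤ f (P.homog v) ∧ (f (P.homog v) = 0 ↔ v ∈ W) := by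
        intro v
        rw [homog, hf, mul_one, hW, hF]
        refine ⟨sub_nonneg.2 (hPb _ (hmem v)), ?_⟩
        rw [sub_eq_zero]
        exact ⟨fun h => ⟨hmem v, h⟩, fun h => h.2⟩
      refine ⟨?_, f, hfW⟩
      rintro rfl
      have hf0 : f = 0 := dual_eq_zero_of_span P.span_range_homog fun v => (hfW v).2.2 (by simp)
      have h1 := hf b 0
      rw [hf0] at h1
      simp only [LinearMap.zero_apply, mul_zero, sub_zero] at h1
      exact hb (inner_self_eq_zero.1 h1.symm)
  · rintro ⟨hWu, f, hf⟩
    by_cases hW : W = ∅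
    · exact Or.inl hW
    obtain ⟨v₀, hv₀⟩ := Finset.nonempty_iff_ne_empty.2 hW
    let b := (InnerProductSpace.toDual ℝ (EuclideanSpace ℝ (Fin d))).symm
      (LinearMap.toContinuousLinearMap (f.comp (LinearMap.inl ℝ _ ℝ)))
    have hb : ∀ e, inner ℝ b e = f (e, 0) := fun e => by simp [b]
    have hfe : ∀ v, f (P.homog v) = inner ℝ b (P.pos v) + f (0, 1) := by
      intro v
      rw [hb, ← map_add, homog]
      simp
    refine Or.inr ⟨_, ⟨b, -f (0, 1), ?_, ?_, rfl, ?_⟩, ?_⟩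
    · intro h
      refine hWu (Finset.eq_univ_iff_forall.2 fun v => (hf v).2.1 ?_)
      rw [← (hf v₀).2.2 hv₀, hfe, hfe, h]
      simp
    · have hsub : convexHull ℝ (Set.range P.pos) ⊆ {e | -f (0, 1) ≤ innerₛₗ ℝ b e} := by
        refine convexHull_min ?_ (convex_halfSpace_ge (LinearMap.isLinear _) _)
        rintro _ ⟨v, rfl⟩
        have := (hf v).1
        rw [hfe] at this
        show -f (0, 1) ≤ inner ℝ b (P.pos v)
        linarith
      exact fun e he => hsub he
    · refine ⟨P.pos v₀, subset_convexHull ℝ _ ⟨v₀, rfl⟩, ?_⟩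
      have := (hf v₀).2.2 hv₀
      rw [hfe] at this
      linarith
    · intro v
      rw [← (hf v).2, hfe]
      constructor
      · intro h
        exact ⟨subset_convexHull ℝ _ ⟨v, rfl⟩, by linarith⟩
      · rintro ⟨-, h⟩
        linarith

/-- Vertices of `P` lying in `F` are extreme in `F`, hence among the points defining the simplex;
the extra coordinate `1` turns affine into linear independence. -/
lemma linearIndepOn_homog_of_isGeometricSimplex (P : SimplicialPolytope d V) {B : Finset V}
    {F : Set (EuclideanSpace ℝ (Fin d))} (hF : IsGeometricSimplex F)
    (hFP : F ⊆ convexHull ℝ (Set.range P.pos)) (hB : ∀ v ∈ B, P.pos v ∈ F) :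
    LinearIndepOn ℝ P.homog (B : Set V) := by
  obtain ⟨s, hs, rfl⟩ := hF
  have hmem : ∀ v ∈ B, P.pos v ∈ s := by
    intro v hv
    have h1 : P.pos v ∈ (convexHull ℝ (Set.range P.pos)).extremePoints ℝ := by
      rw [P.vertices_eq]; exact ⟨v, rfl⟩
    exact extremePoints_convexHull_subset
      (inter_extremePoints_subset_extremePoints_of_subset hFP ⟨hB v hv, h1⟩)
  let j : (B : Set V) ↪ s :=
    ⟨fun v => ⟨P.pos v, hmem v v.2⟩, fun v w h =>
      Subtype.ext (P.pos_injective (congrArg Subtype.val h))⟩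
  have h2 := affineIndependent_iff.1 (hs.comp_embedding j)
  rw [LinearIndepOn, linearIndependent_iff']
  intro t g hg
  refine h2 t g ?_ ?_
  · simpa [homog, Prod.snd_sum] using congrArg Prod.snd hg
  · have := congrArg Prod.fst hg
    simp only [homog, Prod.fst_sum, Prod.smul_mk, Prod.fst_zero] at this
    exact this

/-- A maximal face has rank at least `d`, so when nonempty it comes from a facet, which is a
simplex; its subsets inherit independence. -/
lemma linearIndepOn_homog (P : SimplicialPolytope d V) :
    ∀ W ∈ coneFaces P.homog, LinearIndepOn ℝ P.homog (W : Set V) := by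
  intro W hW
  obtain ⟨B, ⟨hB, hWB⟩, hmax⟩ :=
    (Set.toFinite {B | B ∈ coneFaces P.homog ∧ W ⊆ B}).exists_maximalFor
      Finset.card _ ⟨W, hW, subset_rfl⟩
  rcases B.eq_empty_or_nonempty with rfl | ⟨v₀, hv₀⟩
  · rw [Finset.subset_empty.1 hWB, Finset.coe_empty]
    exact linearIndepOn_empty ℝ _
  have hr : d ≤ Module.finrank ℝ (Submodule.span ℝ (P.homog '' (B : Set V))) := by
    by_contra! h
    obtain ⟨B', hB', hBB'⟩ := exists_ssuperset_mem_coneFaces P.span_range_homog hB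
      (by rw [finrank_homogSpace]; omega)
    have h3 := hmax ⟨hB', hWB.trans hBB'.1⟩ (Finset.card_lt_card hBB').le
    exact absurd (Finset.card_lt_card hBB') (not_lt.2 h3)
  have hBb : B ∈ P.boundary := P.boundary_eq_coneFaces ▸ hB
  obtain rfl | ⟨F, hF, hBF⟩ := hBb
  · simp at hv₀
  refine LinearIndepOn.mono ?_ (Finset.coe_subset.2 hWB)
  have hlow : Module.finrank ℝ (Submodule.span ℝ (P.homog '' (B : Set V))) ≤
      Module.finrank ℝ (vectorSpan ℝ F) + 1 := by
    have hle : Submodule.span ℝ (P.homog '' (B : Set V)) ≤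
        (vectorSpan ℝ F).map (LinearMap.inl ℝ _ ℝ) ⊔ Submodule.span ℝ {P.homog v₀} := by
      rw [Submodule.span_le]
      rintro _ ⟨v, hv, rfl⟩
      refine Submodule.mem_sup.2 ⟨(P.pos v - P.pos v₀, 0), ⟨P.pos v - P.pos v₀, ?_, rfl⟩,
        P.homog v₀, Submodule.mem_span_singleton_self _, by simp [homog]⟩
      exact vsub_mem_vectorSpan ℝ ((hBF v).1 hv) ((hBF v₀).1 hv₀)
    have h0 : P.homog v₀ ≠ 0 := fun h => one_ne_zero (congrArg Prod.snd h)
    calc _ ≤ _ := Submodule.finrank_mono hle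
      _ ≤ _ := Submodule.finrank_add_le_finrank_add_finrank _ _
      _ ≤ _ := add_le_add (Submodule.finrank_map_le _ _) (finrank_span_singleton h0).le
  obtain ⟨b, α, hb, hPb, hFe, -⟩ := id hF
  have hup : Module.finrank ℝ (vectorSpan ℝ F) < d := by
    have hle : vectorSpan ℝ F ≤ LinearMap.ker (innerₛₗ ℝ b) := by
      rw [vectorSpan_def, Submodule.span_le]
      rintro _ ⟨e, he, e', he', rfl⟩
      rw [hFe] at he he'
      show inner ℝ b (e - e') = 0
      rw [inner_sub_right, he.2, he'.2, sub_self]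
    have hlt : LinearMap.ker (innerₛₗ ℝ b) ≠ ⊤ := by
      intro h
      have : b ∈ LinearMap.ker (innerₛₗ ℝ b) := h ▸ Submodule.mem_top
      exact hb (inner_self_eq_zero.1 this)
    have h1 := Submodule.finrank_lt (lt_of_le_of_lt hle hlt.lt_top).ne
    simpa using h1
  refine P.linearIndepOn_homog_of_isGeometricSimplex (P.simplicial F hF (by omega)) ?_
    fun v hv => (hBF v).1 hv
  rw [hFe]
  exact fun e he => he.1

/-! ### Linear relations from stresses -/

/-- The linear relation between the vertices that is obtained from an affine stress by taking
coefficients at a monomial. -/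
lemma sum_coeff_smul_homog_eq_zero (P : SimplicialPolytope d V) {k : ℕ} {lam : MvPolynomial V ℝ}
    (hlam : P.IsStress k lam) (m : V →₀ ℕ) :
    ∑ v, (lam.coeff (m + Finsupp.single v 1) * (m v + 1)) • P.homog v = 0 := by
  have h1 : ∀ i, ∑ v, theta P.pos i v * (lam.coeff (m + Finsupp.single v 1) * (m v + 1)) = 0 := by
    intro i
    have := congrArg (MvPolynomial.coeff m) (hlam.2.2 i)
    simpa [formDeriv, MvPolynomial.coeff_sum, MvPolynomial.coeff_pderiv] using this
  refine Prod.ext ?_ ?_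
  · ext j
    have := h1 j.castSucc
    simp only [theta, Fin.snoc_castSucc] at this
    simpa [homog, Prod.fst_sum, mul_comm] using this
  · have := h1 (Fin.last d)
    simp only [theta, Fin.snoc_last] at this
    simpa [homog, Prod.snd_sum] using this

variable [DecidableEq V]

lemma sqfreeCoeff_eq_zero_of_notMem (P : SimplicialPolytope d V) {k : ℕ}
    {lam : MvPolynomial V ℝ} (hlam : P.IsStress k lam) {G : Finset V} (hG : G ∉ P.boundary) :
    sqfreeCoeff lam G = 0 := by
  by_contra h
  have h1 := hlam.2.1 _ (MvPolynomial.mem_support_iff.2 h)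
  refine hG ?_
  convert h1 using 1
  ext v
  simp [Finsupp.finsetSum_apply, Finsupp.single_apply]

/-- The sign pattern in the sign condition cannot occur for a stress if `M` is a face. -/
lemma notMem_boundary_of_stress (P : SimplicialPolytope d V) {k : ℕ} {lam : MvPolynomial V ℝ}
    (hlam : P.IsStress k lam) {M F : Finset V} (hFM : F ⊂ M)
    (hpos : ∀ v ∈ M, v ∉ F → 0 < sqfreeCoeff lam (insert v F))
    (hnonpos : ∀ v, v ∉ M → sqfreeCoeff lam (insert v F) ≤ 0) : M ∉ P.boundary := by
  intro hM
  rw [P.boundary_eq_coneFaces] at hM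
  have hli := P.linearIndepOn_homog M hM
  obtain ⟨-, f, hf⟩ := hM
  set m : V →₀ ℕ := ∑ u ∈ F, Finsupp.single u 1 with hm
  -- Off `F` the factor `m v + 1` equals `1`. At `v ∈ F` the coefficient belongs to a monomial that
  -- is not squarefree and its sign is unknown, but `f` vanishes there because `F ⊂ M`.
  set a : V → ℝ := fun v => lam.coeff (m + Finsupp.single v 1) * (m v + 1) with ha
  have hrel : ∑ v, a v • P.homog v = 0 := P.sum_coeff_smul_homog_eq_zero hlam m
  have haF : ∀ v, v ∉ F → a v = sqfreeCoeff lam (insert v F) := by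
    intro v hv
    have hmv : m v = 0 := by
      simp [hm, Finsupp.finsetSum_apply, Finsupp.single_apply, hv]
    simp only [ha, hmv]
    rw [sqfreeCoeff, Finset.sum_insert hv, ← hm, add_comm]
    simp
  have hterm : ∀ v, a v * f (P.homog v) ≤ 0 := by
    intro v
    by_cases hv : v ∈ M
    · rw [(hf v).2.2 hv, mul_zero]
    · refine mul_nonpos_of_nonpos_of_nonneg ?_ (hf v).1
      rw [haF v fun h => hv (hFM.1 h)]
      exact hnonpos v hv
  have hsum : ∑ v, a v * f (P.homog v) = 0 := by simpa using congrArg f hrel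
  have hzero : ∀ v, v ∉ M → a v = 0 := by
    intro v hv
    have h1 := (Finset.sum_eq_zero_iff_of_nonpos fun v _ => hterm v).1 hsum v (Finset.mem_univ v)
    exact (mul_eq_zero.1 h1).resolve_right (pos_of_supporting hf hv).ne'
  have hM0 : ∑ v ∈ M, a v • P.homog v = 0 := by
    rw [← hrel]
    exact Finset.sum_subset (Finset.subset_univ M) fun v _ hv => by rw [hzero v hv, zero_smul]
  obtain ⟨v, hvM, hvF⟩ := Finset.exists_of_ssubset hFM
  have h1 := linearIndepOn_finset_iff.1 hli a hM0 v hvM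
  have h2 := hpos v hvM hvF
  rw [← haF v hvF, h1] at h2
  exact lt_irrefl _ h2

end SimplicialPolytope

/-! ### Missing faces and the conclusion -/

lemma exists_missing_subset {V : Type*} {Δ : Set (Finset V)} {W : Finset V} (hW : W ∉ Δ) :
    ∃ M ⊆ W, IsMissingFace Δ M := by
  induction W using Finset.strongInduction with
  | H W ih =>
    by_cases h : ∀ σ, σ ⊂ W → σ ∈ Δ
    · exact ⟨W, subset_rfl, hW, h⟩
    · push Not at h
      obtain ⟨σ, hσ, hσΔ⟩ := h
      obtain ⟨M, hM, hMm⟩ := ih σ hσ hσΔ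
      exact ⟨M, hM.trans hσ.1, hMm⟩

end StressRec

open StressRec SimplicialPolytope in
theorem mainTheorem6 {d k : ℕ} (hk : 2 ≤ k) (hd : 2 * k ≤ d) {V : Type*} [Fintype V]
    (P : StressRec.SimplicialPolytope d V) (hP : P.SignCondition k) :
    P.IsDetermined k := by
  classical
  intro Q hskel hsign
  have hsk : ∀ W : Finset V, W.card ≤ k → (W ∈ coneFaces P.homog ↔ W ∈ coneFaces Q.homog) := by
    intro W hW
    have h1 := Set.ext_iff.1 hskel W
    simp only [skel, Set.mem_ofPred_eq, hW, and_true] at h1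
    rw [← P.boundary_eq_coneFaces, ← Q.boundary_eq_coneFaces, h1]
  have hmissing : ∀ M, IsMissingFace (coneFaces P.homog) M → M ∉ coneFaces Q.homog := by
    intro M hM
    by_cases hMk : M.card ≤ k
    · exact fun h => hM.1 ((hsk M hMk).2 h)
    by_cases hMd : d + 1 < M.card + k
    · exact notMem_coneFaces_of_missing_of_large P.linearIndepOn_homog Q.linearIndepOn_homog
        P.span_range_homog Q.span_range_homog rfl hsk hM (by rw [finrank_homogSpace]; omega)
    rw [← Q.boundary_eq_coneFaces]
    obtain ⟨F, -, hFM, hFk, lam, hlam, hsgn⟩ :=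
      hP M (by rwa [P.boundary_eq_coneFaces]) (by omega) (by omega)
    have hmem : (fun G : {G : Finset V // G.card = k} => SignType.sign (sqfreeCoeff lam G.1)) ∈
        Q.signVectors k := hsign ▸ ⟨lam, hlam, fun _ => rfl⟩
    obtain ⟨mu, hmu, hmus⟩ := hmem
    have hcard : ∀ v, v ∉ F → (insert v F).card = k := fun v hv => by
      rw [Finset.card_insert_of_notMem hv, hFk]
    -- Since `|M| > k`, the sets `insert v F` with `v ∈ M` are proper subsets of the missing face,
    -- hence faces of `P` to which the strict sign condition applies.
    have hss : ∀ v ∈ M, insert v F ⊂ M ∨ v ∈ F := by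
      intro v hv
      by_cases hvF : v ∈ F
      · exact Or.inr hvF
      · left
        rw [Finset.ssubset_iff_subset_ne]
        refine ⟨Finset.insert_subset hv hFM, fun h => hMk ?_⟩
        rw [← h, hcard v hvF]
    refine Q.notMem_boundary_of_stress hmu (F := F) ?_ ?_ ?_
    · rw [Finset.ssubset_iff_subset_ne]
      refine ⟨hFM, ?_⟩
      rintro rfl
      omega
    · intro v hv hvF
      have h1 := (hsgn v hvF (by
        rw [P.boundary_eq_coneFaces]
        exact hM.2 _ ((hss v hv).resolve_right hvF))).1 hv
      have h2 := hmus ⟨insert v F, hcard v hvF⟩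
      simp only [sign_pos h1] at h2
      exact sign_eq_one_iff.1 h2.symm
    · intro v hv
      have hvF : v ∉ F := fun h => hv (hFM h)
      by_cases hb : insert v F ∈ P.boundary
      · have h1 := (hsgn v hvF hb).2 hv
        have h2 := hmus ⟨insert v F, hcard v hvF⟩
        by_contra! h3
        simp only [sign_pos h3] at h2
        exact h1.not_gt (sign_eq_one_iff.1 h2)
      · refine (Q.sqfreeCoeff_eq_zero_of_notMem hmu fun h => hb ?_).le
        rw [P.boundary_eq_coneFaces, hsk _ (hcard v hvF).le, ← Q.boundary_eq_coneFaces]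
        exact h
  rw [Q.boundary_eq_coneFaces, P.boundary_eq_coneFaces]
  refine coneFaces_eq_of_subset P.linearIndepOn_homog Q.linearIndepOn_homog P.span_range_homog
    Q.span_range_homog rfl (Q.boundary_eq_coneFaces ▸ Or.inl rfl) fun W hW => ?_
  by_contra hWP
  obtain ⟨M, hMW, hM⟩ := exists_missing_subset hWP
  exact hmissing M hM (coneFaces_mono Q.linearIndepOn_homog hW hMW)
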